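/- Fix an integer $k\ge 0$ and let $\mathbb S_k$ be the slab: the graph with vertex set $\mathbb Z^2\times\{0,\dots,k\}$ and edges between nearest neighbours. For $p\in[0,1]$ let $\mathbf P_p$ be Bernoulli bond percolation on $\mathbb S_k$: the edges are open with probability $p$, independently. For $E\subset\mathbb Z^2$ put $\overline E=E\times\{0,\dots,k\}$. For $B,X,Y\subset\mathbb Z^2$ let $X\overset{B}{\longleftrightarrow}Y$ be the event that some open cluster in $\overline B$ (a connected component of the graph formed by the vertices of $\overline B$ and the open edges with both endpoints in $\overline B$) contains a vertex of $\overline X$ and a vertex of $\overline Y$. Let $B_n=[-n,n]^2\cap\mathbb Z^2$. Let $(u_m)$, $(\alpha_m)$, $(y_m)$ be sequences of non-negative integers with $u_m\le m/3$, $\alpha_m\le m$ and $y_m\le m$ for all $m$. Put $S_m=B_{u_m}$ and, for $n\ge 1$ and $y=y_{3n}$, $$B_n'=(2n,y)+B_n,\qquad S_n'=(2n,y)+S_n,$$ $$Y_n^+=\{3n\}\times[y+\alpha_n,y+n],\quad Y_n^-=\{3n\}\times[y-n,y-\alpha_n],\quad Z_n=\{3n\}\times[y-\alpha_n,y+\alpha_n]$$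 (intervals of integers). **Gluing Lemma.** For every $\varepsilon>0$ there exists $\delta=\delta(\varepsilon,k)>0$, depending only on $\varepsilon$ and $k$, such that for every $p\in[0,1]$, all sequences $(u_m),(\alpha_m),(y_m)$ as above and every $n\ge 1$, $$\mathbf P_p\big[S_{3n}\overset{B_{3n}}{\longleftrightarrow}Z_n,\ S_n'\overset{B_n'}{\longleftrightarrow}Y_n^-,\ S_n'\overset{B_n'}{\longleftrightarrow}Y_n^+\big]\ge 1-\delta$$ implies $$\mathbf P_p\big[S_{3n}\overset{B_{3n}\cup B_n'}{\longleftrightarrow}S_n'\big]\ge 1-\varepsilon .$$ -/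

import Mathlib

open MeasureTheory
open scoped Pointwise

namespace SlabPercolation

/-- Vertices of the slab of width `k`: the product of `ℤ²` with `{0, …, k}`. -/
abbrev Vertex (k : ℕ) : Type := (ℤ × ℤ) × Fin (k + 1)

/-- The slab of width `k`: two vertices are adjacent when they are nearest neighbours,
that is, at `ℓ¹`-distance one. -/
def slab (k : ℕ) : SimpleGraph (Vertex k) where
  Adj v w := |v.1.1 - w.1.1| + |v.1.2 - w.1.2| + |((v.2 : ℕ) : ℤ) - ((w.2 : ℕ) : ℤ)| = 1
  symm := ⟨fun v w h => by
    rw [abs_sub_comm w.1.1, abs_sub_comm w.1.2, abs_sub_comm ((w.2 : ℕ) : ℤ)]; exact h⟩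
  loopless := ⟨fun v h => by simp at h⟩

/-- A percolation configuration: every edge is open (`true`) or closed (`false`). -/
abbrev Config (k : ℕ) : Type := (slab k).edgeSet → Bool

/-- Bernoulli bond percolation: the edges are independently open with probability `p`. -/
noncomputable def bernoulliPerc (k : ℕ) (p : unitInterval) : Measure (Config k) :=
  Measure.infinitePi fun _ => ProbabilityTheory.bernoulliMeasure true false p

/-- The graph of all vertices of the slab and the open edges of `ω`. -/
def openGraph {k : ℕ} (ω : Config k) : SimpleGraph (Vertex k) where
  Adj v w := ∃ h : s(v, w) ∈ (slab k).edgeSet, ω ⟨s(v, w), h⟩ = true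
  symm := ⟨fun v w ⟨h, ho⟩ => by
    have e : s(w, v) = s(v, w) := Sym2.eq_swap
    rw [e]; exact ⟨h, ho⟩⟩
  loopless := ⟨fun v ⟨h, _⟩ => (slab k).loopless.irrefl v h⟩

/-- The set of vertices of the slab whose first two coordinates lie in `E`. -/
def lift (k : ℕ) (E : Set (ℤ × ℤ)) : Set (Vertex k) := {v | v.1 ∈ E}

/-- The event that some open cluster in `lift k B` (a connected component of the graph of the
vertices of `lift k B` and the open edges with both endpoints there) meets `lift k X` and
`lift k Y`. -/
def connected (k : ℕ) (B X Y : Set (ℤ × ℤ)) : Set (Config k) :=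
  {ω | ∃ C : ((openGraph ω).induce (lift k B)).ConnectedComponent,
    (∃ x ∈ C.supp, (x : Vertex k) ∈ lift k X) ∧ (∃ y ∈ C.supp, (y : Vertex k) ∈ lift k Y)}

/-- The box `[-n, n]²` in `ℤ²`. -/
def box (n : ℕ) : Set (ℤ × ℤ) := Set.Icc (-(n : ℤ)) n ×ˢ Set.Icc (-(n : ℤ)) n

section Sets

variable (u α y : ℕ → ℕ) (n : ℕ)

/-- The box `Sₙ = B_{uₙ}`. -/
def S : Set (ℤ × ℤ) := box (u n)

/-- `B'ₙ = (2n, y₃ₙ) + Bₙ`. -/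
def B' : Set (ℤ × ℤ) := ((2 * n : ℤ), (y (3 * n) : ℤ)) +ᵥ box n

/-- `S'ₙ = (2n, y₃ₙ) + Sₙ`. -/
def S' : Set (ℤ × ℤ) := ((2 * n : ℤ), (y (3 * n) : ℤ)) +ᵥ S u n

/-- `Yₙ⁺ = {3n} × [y₃ₙ + αₙ, y₃ₙ + n]`. -/
def Yplus : Set (ℤ × ℤ) :=
  {(3 * n : ℤ)} ×ˢ Set.Icc ((y (3 * n) : ℤ) + α n) ((y (3 * n) : ℤ) + n)

/-- `Yₙ⁻ = {3n} × [y₃ₙ - n, y₃ₙ - αₙ]`. -/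
def Yminus : Set (ℤ × ℤ) :=
  {(3 * n : ℤ)} ×ˢ Set.Icc ((y (3 * n) : ℤ) - n) ((y (3 * n) : ℤ) - α n)

/-- `Zₙ = {3n} × [y₃ₙ - αₙ, y₃ₙ + αₙ]`. -/
def Z : Set (ℤ × ℤ) :=
  {(3 * n : ℤ)} ×ˢ Set.Icc ((y (3 * n) : ℤ) - α n) ((y (3 * n) : ℤ) + α n)

end Sets

end SlabPercolation

/-!
Everything happens in the finite region above the two boxes. Besides the states of the edges we draw
one more random bit for every ordered pair of vertices, whose law is that of an edge. These bits
single out a best open crossing `γ` from `S` to `Z`, the lexicographically smallest one for the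
preferences that they encode. If `S` and `S'` are not connected, planarity forces the paths from
`S'` to `Yminus` and `Yplus` to enter the columns of `γ`, so that some of these columns are
*candidates*: next to them comes a vertex connected to `S'` off the columns of `γ`.

If there are at most `t` candidates, closing the edges around them, except those of `γ`, destroys
the arms. The modification costs a constant factor that depends on `t`, so this case is at most a
constant times as likely as the absence of the arms. If there are more than `t` candidates, a local
surgery in any one of them connects `S` to `S'`. It makes the vertices of `γ` in the column prefer
their successors, so that `γ` remains the best crossing and the column can be recovered as the only
one where `γ` touches the cluster of `S'`. The surgery is thus a multi-valued map with at least `t`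
images, whose preimages are bounded in number: this case has probability `O(1 / t)`.

Both arguments need the probability of an open edge to be bounded away from `0` and `1`. Near `0`,
the arms contain a long open path. Near `1`, the absence of a connection between two arms forces a
long chain of closed edges, by a parity argument along the boundary of the cluster of `S`. Both are
unlikely by Peierls' argument.
-/

namespace SlabPercolation

section IidMeasure

variable {ι κ α : Type*} [MeasurableSpace α]

/-- The joint law of independent variables indexed by `ι` with common law `μ`. -/
noncomputable abbrev iidMeasure (ι : Type*) (μ : Measure α) [IsProbabilityMeasure μ] :
    Measure (ι → α) :=
  Measure.infinitePi fun _ => μ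

variable (μ : Measure α) [IsProbabilityMeasure μ]

lemma iidMeasure_map_comp {f : ι → κ} (hf : Function.Injective f) :
    (iidMeasure κ μ).map (fun ω => ω ∘ f) = iidMeasure ι μ := by
  classical
  refine Measure.eq_infinitePi _ fun s t ht => ?_
  have preimage_box : (fun ω : κ → α => ω ∘ f) ⁻¹' Set.pi s t =
      Set.pi (s.image f) (Function.extend f t fun _ => Set.univ) := by
    ext ω
    simp [Set.mem_pi, hf.extend_apply]
  have measurable_sides (j : κ) : MeasurableSet (Function.extend f t (fun _ => Set.univ) j) := by
    by_cases hj : ∃ i, f i = j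
    · obtain ⟨i, rfl⟩ := hj
      simpa only [hf.extend_apply] using ht i
    · simp only [Function.extend_apply' _ _ _ hj, MeasurableSet.univ]
  rw [Measure.map_apply (by fun_prop) (MeasurableSet.pi s.countable_toSet fun i _ => ht i),
    preimage_box, Measure.infinitePi_pi _ fun j _ => measurable_sides j,
    Finset.prod_image fun _ _ _ _ h => hf h]
  simp only [hf.extend_apply]

variable [MeasurableSingletonClass α]

lemma iidMeasure_real_comp_mem [Finite ι] [Countable α] {f : ι → κ} (hf : Function.Injective f)
    (A : Set (ι → α)) :
    (iidMeasure κ μ).real {ω | ω ∘ f ∈ A} = (iidMeasure ι μ).real A := by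
  rw [← iidMeasure_map_comp μ hf,
    map_measureReal_apply (by fun_prop) A.to_countable.measurableSet]
  rfl

lemma iidMeasure_real_forall_mem_eq (a : α) (s : Finset ι) :
    (iidMeasure ι μ).real {ω | ∀ i ∈ s, ω i = a} = μ.real {a} ^ s.card := by
  have isBox : {ω : ι → α | ∀ i ∈ s, ω i = a} = Set.pi s fun _ => {a} := by
    ext ω
    simp [Set.mem_pi]
  rw [isBox, measureReal_def, Measure.infinitePi_pi _ fun _ _ => measurableSet_singleton a,
    ENNReal.toReal_prod, Finset.prod_const, measureReal_def]

variable [Fintype ι]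

lemma iidMeasure_real_singleton (ω : ι → α) :
    (iidMeasure ι μ).real {ω} = ∏ i, μ.real {ω i} := by
  simp only [measureReal_def, Measure.infinitePi_singleton_of_fintype, ENNReal.toReal_prod]

end IidMeasure

section Modification

lemma mul_measureReal_le_of_multivalued_map {Ω : Type*} [Finite Ω] [MeasurableSpace Ω]
    [MeasurableSingletonClass Ω] (P : Measure Ω) [IsFiniteMeasure P] {A D : Set Ω}
    (R : Ω → Ω → Prop) {t N : ℕ} {K : ℝ} (hK : 0 ≤ K)
    (hA : ∀ ω ∈ A, ∃ T : Finset Ω, t ≤ T.card ∧ ∀ ω' ∈ T, ω' ∈ D ∧ R ω ω')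
    (hD : ∀ ω' ∈ D, {ω | R ω ω'}.ncard ≤ N)
    (hR : ∀ ω ω', R ω ω' → P.real {ω} ≤ K * P.real {ω'}) :
    t * P.real A ≤ N * K * P.real D := by
  classical
  have := Fintype.ofFinite Ω
  have real_eq_sum (E : Set Ω) : P.real E = ∑ ω with ω ∈ E, P.real {ω} := by
    rw [sum_measureReal_singleton]
    simp
  have le_sum_successors (ω) (hω : ω ∈ A) :
      t * P.real {ω} ≤ ∑ ω' with ω' ∈ D, if R ω ω' then K * P.real {ω'} else 0 := by
    obtain ⟨T, ht, hT⟩ := hA ω hω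
    calc t * P.real {ω} ≤ ∑ _ω' ∈ T, P.real {ω} := by
          rw [Finset.sum_const, nsmul_eq_mul]
          gcongr
      _ ≤ ∑ ω' ∈ T, if R ω ω' then K * P.real {ω'} else 0 := by
          refine Finset.sum_le_sum fun ω' h' => ?_
          rw [if_pos (hT ω' h').2]
          exact hR _ _ (hT ω' h').2
      _ ≤ _ := Finset.sum_le_sum_of_subset_of_nonneg
          (fun ω' h' => Finset.mem_filter_univ _ |>.2 (hT ω' h').1) fun ω' _ _ => by positivity
  have sum_predecessors_le (ω') (hω' : ω' ∈ D) :
      ∑ ω with ω ∈ A, (if R ω ω' then K * P.real {ω'} else 0) ≤ N * (K * P.real {ω'}) := by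
    rw [← Finset.sum_filter, Finset.sum_const, nsmul_eq_mul]
    gcongr
    refine le_trans ?_ (hD ω' hω')
    rw [← Set.ncard_coe_finset]
    exact Set.ncard_le_ncard fun ω h => (Finset.mem_filter.1 h).2
  calc t * P.real A = ∑ ω with ω ∈ A, t * P.real {ω} := by rw [real_eq_sum A, Finset.mul_sum]
    _ ≤ ∑ ω with ω ∈ A, ∑ ω' with ω' ∈ D, if R ω ω' then K * P.real {ω'} else 0 :=
        Finset.sum_le_sum fun ω h => le_sum_successors ω (by simpa using h)
    _ = ∑ ω' with ω' ∈ D, ∑ ω with ω ∈ A, if R ω ω' then K * P.real {ω'} else 0 :=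
        Finset.sum_comm
    _ ≤ ∑ ω' with ω' ∈ D, N * (K * P.real {ω'}) :=
        Finset.sum_le_sum fun ω' h => sum_predecessors_le ω' (by simpa using h)
    _ = N * K * P.real D := by simp only [real_eq_sum D, Finset.mul_sum, mul_assoc]

lemma ncard_eqOn_compl_le {ι α : Type*} [Finite α] [Nonempty α] {F : Finset ι} {s : ℕ}
    (hF : F.card ≤ s) (ω' : ι → α) :
    {ω : ι → α | ∀ i ∉ F, ω i = ω' i}.ncard ≤ Nat.card α ^ s := by
  have restrict_injOn : Set.InjOn (fun (ω : ι → α) (i : F) => ω i)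
      {ω | ∀ i ∉ F, ω i = ω' i} := fun ω₁ h₁ ω₂ h₂ h => by
    funext i
    by_cases hi : i ∈ F
    · exact congrFun h ⟨i, hi⟩
    · rw [h₁ i hi, h₂ i hi]
  calc _ ≤ (Set.univ : Set (F → α)).ncard :=
        Set.ncard_le_ncard_of_injOn _ (fun _ _ => Set.mem_univ _) restrict_injOn
    _ = Nat.card α ^ F.card := by
        rw [Set.ncard_univ, Nat.card_fun, Nat.card_eq_fintype_card (α := F), Fintype.card_coe]
    _ ≤ Nat.card α ^ s := Nat.pow_le_pow_right Nat.card_pos hF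

variable {ι α : Type*} [Finite ι] [MeasurableSpace α] [MeasurableSingletonClass α]
  {μ : Measure α} [IsProbabilityMeasure μ]

lemma iidMeasure_real_singleton_le_of_eqOn_compl {m : ℝ} (hm : 0 < m) (hμ : ∀ a, m ≤ μ.real {a})
    {F : Finset ι} {s : ℕ} (hF : F.card ≤ s) {ω ω' : ι → α} (h : ∀ i ∉ F, ω i = ω' i) :
    (iidMeasure ι μ).real {ω} ≤ m⁻¹ ^ s * (iidMeasure ι μ).real {ω'} := by
  classical
  have := Fintype.ofFinite ι
  have hm1 : m ≤ 1 := by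
    obtain ⟨a⟩ := μ.nonempty_of_neZero
    exact (hμ a).trans measureReal_le_one
  have pow_le_prod : m ^ s ≤ ∏ i ∈ F, μ.real {ω' i} :=
    calc m ^ s ≤ m ^ F.card := pow_le_pow_of_le_one hm.le hm1 hF
      _ = ∏ _i ∈ F, m := (Finset.prod_const m).symm
      _ ≤ _ := Finset.prod_le_prod (fun _ _ => hm.le) fun i _ => hμ _
  rw [iidMeasure_real_singleton, iidMeasure_real_singleton, inv_pow, inv_mul_eq_div,
    le_div_iff₀ (by positivity), mul_comm]
  calc m ^ s * ∏ i, μ.real {ω i}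
      = m ^ s * ((∏ i ∈ F, μ.real {ω i}) * ∏ i ∈ Fᶜ, μ.real {ω' i}) := by
        rw [← Finset.prod_mul_prod_compl F, Finset.prod_congr (rfl : Fᶜ = Fᶜ) fun i hi => by
          rw [h i (Finset.mem_compl.1 hi)]]
    _ ≤ (∏ i ∈ F, μ.real {ω' i}) * (1 * ∏ i ∈ Fᶜ, μ.real {ω' i}) := by
        gcongr
        exact Finset.prod_le_one (fun _ _ => measureReal_nonneg) fun _ _ => measureReal_le_one
    _ = ∏ i, μ.real {ω' i} := by rw [one_mul, Finset.prod_mul_prod_compl]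

/-- The set `F ω'` of modified coordinates has to be recoverable from the result `ω'` alone: this
is what bounds the number of configurations leading to `ω'`. -/
theorem mul_iidMeasure_real_le_of_modification [Finite α] {m : ℝ} (hm : 0 < m)
    (hμ : ∀ a, m ≤ μ.real {a}) {s t : ℕ} {A D : Set (ι → α)} (F : (ι → α) → Finset ι)
    (hF : ∀ ω' ∈ D, (F ω').card ≤ s)
    (hA : ∀ ω ∈ A, ∃ T : Finset (ι → α), t ≤ T.card ∧
      ∀ ω' ∈ T, ω' ∈ D ∧ ∀ i ∉ F ω', ω i = ω' i) :
    t * (iidMeasure ι μ).real A ≤ (Nat.card α * m⁻¹) ^ s * (iidMeasure ι μ).real D := by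
  have := μ.nonempty_of_neZero
  have h := mul_measureReal_le_of_multivalued_map (iidMeasure ι μ) (A := A) (D := D)
    (fun ω ω' => ω' ∈ D ∧ ∀ i ∉ F ω', ω i = ω' i) (N := Nat.card α ^ s) (K := m⁻¹ ^ s)
    (by positivity)
    (fun ω hω => (hA ω hω).imp fun T hT => ⟨hT.1, fun ω' h' => ⟨(hT.2 ω' h').1, hT.2 ω' h'⟩⟩)
    (fun ω' hω' => (Set.ncard_le_ncard fun ω h => h.2).trans (ncard_eqOn_compl_le (hF ω' hω') ω'))
    fun ω ω' h => iidMeasure_real_singleton_le_of_eqOn_compl hm hμ (hF ω' h.1) h.2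
  rwa [Nat.cast_pow, ← mul_pow] at h

end Modification

section Reachability

/-- `y` can be reached from `x` by steps of `r` between elements of `A`. -/
def ReachIn {V : Type*} (r : V → V → Prop) (A : Set V) (x y : V) : Prop :=
  x ∈ A ∧ Relation.ReflTransGen (fun v w => r v w ∧ v ∈ A ∧ w ∈ A) x y

namespace ReachIn

variable {V : Type*} {r r' : V → V → Prop} {A A' : Set V} {x y z : V}

lemma refl (h : x ∈ A) : ReachIn r A x x := ⟨h, .refl⟩

lemma left_mem (h : ReachIn r A x y) : x ∈ A := h.1

lemma propagates {p : V → Prop} (h : ReachIn r A x y) (hx : p x)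
    (hstep : ∀ v ∈ A, ∀ w ∈ A, r v w → p v → p w) : p y := by
  obtain ⟨-, h⟩ := h
  induction h with
  | refl => exact hx
  | tail _ hvw hv => exact hstep _ hvw.2.1 _ hvw.2.2 hvw.1 hv

lemma right_mem (h : ReachIn r A x y) : y ∈ A :=
  h.propagates h.left_mem fun _ _ _ hw _ _ => hw

lemma tail (h : ReachIn r A x y) (hr : r y z) (hz : z ∈ A) : ReachIn r A x z :=
  ⟨h.1, h.2.tail ⟨hr, h.right_mem, hz⟩⟩

lemma trans (h : ReachIn r A x y) (h' : ReachIn r A y z) : ReachIn r A x z :=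
  ⟨h.1, h.2.trans h'.2⟩

lemma mono (h : ReachIn r A x y) (hr : ∀ v ∈ A, ∀ w ∈ A, r v w → r' v w) (hA : A ⊆ A') :
    ReachIn r' A' x y :=
  ⟨hA h.1, Relation.ReflTransGen.mono
    (fun v w ⟨hvw, hv, hw⟩ => ⟨hr v hv w hw hvw, hA hv, hA hw⟩) _ _ h.2⟩

lemma symm [Std.Symm r] (h : ReachIn r A x y) : ReachIn r A y x :=
  h.propagates (p := fun v => ReachIn r A v x) (refl h.left_mem) fun _ hv _ hw hvw hvx =>
    ((refl hw).tail (Std.Symm.symm _ _ hvw) hv).trans hvx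

end ReachIn

variable {V W : Type*} {r : V → V → Prop}

lemma ReachIn.map {r' : W → W → Prop} {A : Set V} {A' : Set W} {x y : V} (h : ReachIn r A x y)
    (f : V → W) (hr : ∀ v ∈ A, ∀ w ∈ A, r v w → r' (f v) (f w)) (hA : Set.MapsTo f A A') :
    ReachIn r' A' (f x) (f y) :=
  h.propagates (p := fun y => ReachIn r' A' (f x) (f y)) (.refl (hA h.left_mem))
    fun v hv w hw hvw ih => ih.tail (hr v hv w hw hvw) (hA hw)

lemma reachIn_subtype_iff {A B : Set V} (hAB : A ⊆ B) {x y : B} :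
    ReachIn (fun v w : B => r v w) {v | v.1 ∈ A} x y ↔ ReachIn r A x y := by
  refine ⟨fun h => h.map Subtype.val (fun _ _ _ _ h => h) fun _ hv => hv, fun h => ?_⟩
  obtain ⟨_, h⟩ := h.propagates
    (p := fun y => ∃ hy : y ∈ B, ReachIn (fun v w : B => r v w) {v | v.1 ∈ A} x ⟨y, hy⟩)
    ⟨x.2, .refl h.left_mem⟩ fun _ _ w hw hvw ⟨_, ih⟩ => ⟨hAB hw, ih.tail hvw hw⟩
  exact h

lemma reachIn_of_isChain {a b : V} {l : List V} (hl : (a :: l).IsChain r)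
    (hb : b ∈ (a :: l).getLast?) : ReachIn r {v | v ∈ a :: l} a b := by
  induction l generalizing a with
  | nil =>
    obtain rfl : a = b := by simpa using hb
    exact .refl (List.mem_singleton_self a)
  | cons c l ih =>
    rw [List.isChain_cons_cons] at hl
    rw [List.getLast?_cons_cons] at hb
    have first_step : ReachIn r {v | v ∈ a :: c :: l} a c :=
      (ReachIn.refl (A := {v | v ∈ a :: c :: l}) (x := a) (by simp)).tail hl.1 (by simp)
    exact first_step.trans
      ((ih hl.2 hb).mono (fun _ _ _ _ h => h) fun _ hv => List.mem_cons_of_mem _ hv)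

end Reachability

section Lists

variable {V : Type*} {r : V → V → Prop}

lemma exists_nodup_isChain {a b : V} (h : Relation.ReflTransGen r a b) :
    ∃ l : List V, (a :: l).IsChain r ∧ (a :: l).Nodup ∧ (a :: l).getLast? = some b := by
  induction h using Relation.ReflTransGen.head_induction_on with
  | refl => exact ⟨[], by simp⟩
  | @head a c hac _ ih =>
    obtain ⟨l, hchain, hnodup, hlast⟩ := ih
    by_cases ha : a ∈ c :: l
    · obtain ⟨s, t, hst⟩ := List.append_of_mem ha
      rw [hst] at hchain hnodup hlast
      refine ⟨t, (List.isChain_split.1 hchain).2, hnodup.of_append_right, ?_⟩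
      rw [← hlast, List.getLast?_append_of_ne_nil _ (List.cons_ne_nil a t)]
    · exact ⟨c :: l, hchain.cons_cons hac, List.nodup_cons.2 ⟨ha, hnodup⟩, by
        rw [List.getLast?_cons_cons, hlast]⟩

lemma exists_first_difference {a b : List V} (hab : ¬ a <+: b) (hba : ¬ b <+: a) :
    ∃ l x y s t, x ≠ y ∧ a = l ++ x :: s ∧ b = l ++ y :: t := by
  induction a generalizing b with
  | nil => exact (hab List.nil_prefix).elim
  | cons x s ih =>
    cases b with
    | nil => exact (hba List.nil_prefix).elim
    | cons y t =>
      by_cases hxy : x = y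
      · subst hxy
        rw [List.prefix_cons_inj] at hab hba
        obtain ⟨l, x', y', s', t', hne, rfl, rfl⟩ := ih hab hba
        exact ⟨x :: l, x', y', s', t', hne, rfl, rfl⟩
      · exact ⟨[], x, y, s, t, hxy, rfl, rfl⟩

lemma rel_of_pair_infix {l : List V} (h : l.IsChain r) {a b : V} (hab : [a, b] <:+: l) :
    r a b := by
  simpa only [List.isChain_pair] using h.infix hab

lemma eq_of_pair_infix_of_nodup {l : List V} (hl : l.Nodup) {a b c : V}
    (hb : [a, b] <:+: l) (hc : [a, c] <:+: l) : b = c := by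
  obtain ⟨s, t, rfl⟩ := hb
  obtain ⟨s', t', h⟩ := hc
  simp only [List.append_assoc, List.cons_append, List.nil_append] at h hl
  have notMem_tail : a ∉ c :: t' :=
    (List.nodup_cons.1 (h ▸ hl : (s' ++ a :: c :: t').Nodup).of_append_right).1
  have notMem_init : a ∉ s' := fun hs =>
    (h ▸ hl : (s' ++ a :: c :: t').Nodup).disjoint hs List.mem_cons_self
  have tails_eq := ((List.append_cons_inj_of_notMem notMem_init notMem_tail).1 h).2.2
  exact (List.cons.inj tails_eq).1.symm

end Lists

section Priority

/-- The independent bits of the gluing argument: one per edge, telling whether it is open, and one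
per ordered pair of vertices, telling whether the first vertex prefers the second one as its
successor on a path. -/
abbrev Coord (V : Type*) : Type _ := Sym2 V ⊕ (V × V)

/-- An assignment of all the bits in `Coord V`. -/
abbrev State (V : Type*) : Type _ := Coord V → Bool

variable {V : Type*} (η : State V)

/-- The rank of `x` among the possible successors of `u?` (`none` stands for the start of a path);
a smaller rank is better. Preferred successors come first and ties are broken by a fixed order. -/
def prio (u? : Option V) (x : V) : Bool ×ₗ V :=
  toLex (u?.elim false fun u => !η (.inr (u, x)), x)

/-- The ranks of the successive vertices of a list whose predecessor is `u?`. -/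
def code (u? : Option V) : List V → List (Bool ×ₗ V)
  | [] => []
  | x :: l => prio η u? x :: code (some x) l

lemma prio_injective (u? : Option V) : Function.Injective (prio η u?) := fun _ _ h =>
  (Prod.ext_iff.1 (toLex.injective h)).2

lemma code_append_cons (u? : Option V) (l : List V) (x : V) (s : List V) :
    code η u? (l ++ x :: s) =
      code η u? l ++ prio η (l.getLast?.or u?) x :: code η (some x) s := by
  induction l generalizing u? with
  | nil => rfl
  | cons y l ih =>
    simp only [List.cons_append, code, ih (some y), List.getLast?_cons, Option.some_or]
    cases l.getLast? <;> rfl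

lemma code_lt_code [LinearOrder V] {l : List V} {x y : V}
    (h : prio η l.getLast? x < prio η l.getLast? y) (s t : List V) :
    code η none (l ++ x :: s) < code η none (l ++ y :: t) := by
  rw [code_append_cons, code_append_cons, Option.or_none]
  exact List.append_left_lt (List.Lex.rel h)

lemma prio_congr {η η' : State V} {u? : Option V} {x : V}
    (h : ∀ u ∈ u?, η (.inr (u, x)) = η' (.inr (u, x))) : prio η u? x = prio η' u? x := by
  cases u? with
  | none => rfl
  | some u => simp only [prio, Option.elim_some, h u rfl]

end Priority

/-- The data of the gluing lemma on a graph `G` whose vertices are grouped into columns: one path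
runs inside `B` from `S` to `Z`, and two further ones inside `B'` from `S'` to `Yminus` and to
`Yplus`. -/
structure GluingData (V P : Type*) where
  G : SimpleGraph V
  /-- The column of a vertex. -/
  col : V → P
  B : Set V
  B' : Set V
  S : Set V
  S' : Set V
  Z : Set V
  Yminus : Set V
  Yplus : Set V

namespace GluingData

variable {V P : Type*} (D : GluingData V P)

/-- `v` and `w` are joined by an edge that is open in `η`. -/
def OpenAdj (η : State V) (v w : V) : Prop := D.G.Adj v w ∧ η (.inl s(v, w)) = true

instance (η : State V) : Std.Symm (D.OpenAdj η) :=
  ⟨fun _ _ h => ⟨h.1.symm, by rw [Sym2.eq_swap]; exact h.2⟩⟩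

/-- Some open path within `A` joins `X` to `Y`. -/
def Joins (η : State V) (A X Y : Set V) : Prop :=
  ∃ x ∈ X, ∃ y ∈ Y, ReachIn (D.OpenAdj η) A x y

/-- An open step in `B` that does not enter `S` and does not leave `Z`. -/
def Step (η : State V) (v w : V) : Prop :=
  D.OpenAdj η v w ∧ v ∈ D.B ∧ w ∈ D.B ∧ w ∉ D.S ∧ v ∉ D.Z

/-- `γ` is a simple open path in `B` from `S` to `Z`, meeting `S` only at its start and `Z` only
at its end. -/
structure IsCrossing (η : State V) (γ : List V) : Prop where
  isChain : γ.IsChain (D.Step η)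
  nodup : γ.Nodup
  head : ∃ a ∈ γ.head?, a ∈ D.S ∧ a ∈ D.B
  last : ∃ b ∈ γ.getLast?, b ∈ D.Z

variable {D} {η : State V} {γ : List V}

/-- Start from the last visit to `S` and end at the first visit to `Z` that follows it. -/
lemma exists_isCrossing (h : D.Joins η D.B D.S D.Z) : ∃ γ, D.IsCrossing η γ := by
  obtain ⟨x, hx, y, hy, hxB, hxy⟩ := h
  have exists_steps : ∃ a ∈ D.S, a ∈ D.B ∧ ∃ b ∈ D.Z, Relation.ReflTransGen (D.Step η) a b := by
    suffices (∃ a ∈ D.S, a ∈ D.B ∧ ∃ b ∈ D.Z, Relation.ReflTransGen (D.Step η) a b) ∨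
        ∃ b ∈ D.Z, Relation.ReflTransGen (D.Step η) x b from
      this.elim id fun hxb => ⟨x, hx, hxB, hxb⟩
    clear hx hxB
    induction hxy using Relation.ReflTransGen.head_induction_on with
    | refl => exact .inr ⟨y, hy, .refl⟩
    | @head v w hvw _ ih =>
      rcases ih with h | ⟨b, hb, hwb⟩
      · exact .inl h
      by_cases hv : v ∈ D.Z
      · exact .inr ⟨v, hv, .refl⟩
      by_cases hw : w ∈ D.S
      · exact .inl ⟨w, hw, hvw.2.2, b, hb, hwb⟩
      · exact .inr ⟨b, hb, .head ⟨hvw.1, hvw.2.1, hvw.2.2, hw, hv⟩ hwb⟩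
  obtain ⟨a, ha, haB, b, hb, hab⟩ := exists_steps
  obtain ⟨l, hchain, hnodup, hlast⟩ := exists_nodup_isChain hab
  exact ⟨a :: l, hchain, hnodup, ⟨a, rfl, ha, haB⟩, ⟨b, hlast, hb⟩⟩

namespace IsCrossing

lemma mem_B (h : D.IsCrossing η γ) {v : V} (hv : v ∈ γ) : v ∈ D.B := by
  obtain ⟨a, ha, -, haB⟩ := h.head
  refine h.isChain.induction (· ∈ D.B) γ (fun _ _ hstep _ => hstep.2.2.1) (fun hne => ?_) v hv
  rwa [← Option.some_inj.1 ((List.head?_eq_some_head hne).symm.trans ha)] at haB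

lemma notMem_S {l s : List V} {v : V} (h : D.IsCrossing η (l ++ v :: s)) (hl : l ≠ []) :
    v ∉ D.S := by
  obtain ⟨l, u, rfl⟩ := List.eq_nil_or_concat l |>.resolve_left hl
  have hstep : D.Step η u v := rel_of_pair_infix h.isChain ⟨l, s, by simp⟩
  exact hstep.2.2.2.1

lemma eq_of_isPrefix {σ : List V} (h : D.IsCrossing η γ) (h' : D.IsCrossing η σ) (hp : γ <+: σ) :
    γ = σ := by
  obtain ⟨b, hb, hbZ⟩ := h.last
  obtain ⟨l, rfl⟩ := List.getLast?_eq_some_iff.1 hb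
  obtain ⟨_ | ⟨x, s⟩, rfl⟩ := hp
  · exact (List.append_nil _).symm
  · have hstep : D.Step η b x := rel_of_pair_infix h'.isChain ⟨l, s, by simp⟩
    exact (hstep.2.2.2.2 hbZ).elim

lemma reachIn (h : D.IsCrossing η γ) {v : V} (hv : v ∈ γ) :
    ∃ a ∈ D.S, ReachIn (D.OpenAdj η) Set.univ a v := by
  obtain ⟨a, ha, haS, -⟩ := h.head
  refine ⟨a, haS, h.isChain.induction (ReachIn (D.OpenAdj η) Set.univ a) γ
    (fun _ _ hstep hreach => hreach.tail hstep.1 trivial) (fun hne => ?_) v hv⟩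
  rw [← Option.some_inj.1 ((List.head?_eq_some_head hne).symm.trans ha)]
  exact .refl trivial

end IsCrossing

section MinimalPath

variable [LinearOrder V]

variable (D) in
/-- `γ` is the best crossing path: wherever another one branches off, `γ` takes the vertex of
smaller rank. -/
def IsMin (η : State V) (γ : List V) : Prop :=
  D.IsCrossing η γ ∧ ∀ l x y s g, γ = l ++ y :: g → D.IsCrossing η (l ++ x :: s) →
    prio η l.getLast? y ≤ prio η l.getLast? x

/-- The crossing path whose list of ranks is lexicographically smallest. -/
lemma exists_isMin [Finite V] (h : D.Joins η D.B D.S D.Z) : ∃ γ, D.IsMin η γ := by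
  have := Fintype.ofFinite V
  have finite_crossings : {γ | D.IsCrossing η γ}.Finite :=
    (List.finite_length_le V (Fintype.card V)).subset fun γ hγ => hγ.nodup.length_le_card
  obtain ⟨γ, hγ, hmin⟩ :=
    Set.exists_min_image _ (code η none) finite_crossings (exists_isCrossing h)
  refine ⟨γ, hγ, fun l x y s g e hx => ?_⟩
  by_contra! hlt
  exact (hmin _ hx).not_gt (e ▸ code_lt_code η hlt s g)

namespace IsMin

lemma unique {σ : List V} (h : D.IsMin η γ) (h' : D.IsMin η σ) : γ = σ := by
  by_contra hne
  obtain ⟨l, x, y, s, t, hxy, rfl, rfl⟩ := exists_first_difference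
    (fun hp => hne (h.1.eq_of_isPrefix h'.1 hp)) (fun hp => hne (h'.1.eq_of_isPrefix h.1 hp).symm)
  exact hxy (prio_injective η _ (le_antisymm (h.2 _ _ _ _ _ rfl h'.1) (h'.2 _ _ _ _ _ rfl h.1)))

lemma of_closing_edges {η' : State V} (h : D.IsMin η γ)
    (hle : ∀ e, η' (.inl e) = true → η (.inl e) = true) (hbit : ∀ d, η' (.inr d) = η (.inr d))
    (hγ : ∀ a b, [a, b] <:+: γ → η' (.inl s(a, b)) = true) : D.IsMin η' γ := by
  have isCrossing_of (σ : List V) (hσ : D.IsCrossing η' σ) : D.IsCrossing η σ :=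
    ⟨hσ.isChain.imp fun v w hvw => ⟨⟨hvw.1.1, hle _ hvw.1.2⟩, hvw.2⟩, hσ.nodup, hσ.head, hσ.last⟩
  refine ⟨⟨?_, h.1.nodup, h.1.head, h.1.last⟩, fun l x y s g e hx => ?_⟩
  · rw [List.isChain_iff_forall_rel_of_append_cons_cons]
    intro a b l₁ l₂ e
    have hab : [a, b] <:+: γ := ⟨l₁, l₂, by simp [e]⟩
    have hstep := rel_of_pair_infix h.1.isChain hab
    exact ⟨⟨hstep.1.1, hγ a b hab⟩, hstep.2⟩
  · rw [prio_congr fun u _ => hbit (u, y), prio_congr fun u _ => hbit (u, x)]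
    exact h.2 l x y s g e (isCrossing_of _ hx)

end IsMin

variable (D) in
/-- The best crossing path; an arbitrary list if there is none. -/
noncomputable def minPath (η : State V) : List V := Classical.epsilon (D.IsMin η)

lemma IsMin.minPath_eq (h : D.IsMin η γ) : D.minPath η = γ :=
  (Classical.epsilon_spec ⟨γ, h⟩).unique h

end MinimalPath

lemma IsCrossing.splice {p q p' q' : List V} {b : V} (h : D.IsCrossing η (p ++ b :: q))
    (h' : D.IsCrossing η (p' ++ b :: q')) (hdisj : p.Disjoint (b :: q')) :
    D.IsCrossing η (p ++ b :: q') where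
  isChain := List.isChain_split.2
    ⟨(List.isChain_split.1 h.isChain).1, (List.isChain_split.1 h'.isChain).2⟩
  nodup := h.nodup.of_append_left.append h'.nodup.of_append_right hdisj
  head := by simpa only [List.head?_append, List.head?_cons] using h.head
  last := by
    simpa only [List.getLast?_append, List.getLast?_cons, Option.some_or] using h'.last

section Surgery

variable (D) in
/-- The vertices joined to `S'` by open paths. -/
def cluster (η : State V) : Set V := {x | ∃ s ∈ D.S', ReachIn (D.OpenAdj η) Set.univ s x}

lemma mem_cluster_of_openAdj {x y : V} (hx : x ∈ D.cluster η) (hxy : D.OpenAdj η x y) :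
    y ∈ D.cluster η :=
  hx.imp fun _ hs => ⟨hs.1, hs.2.tail hxy trivial⟩

variable (D) in
/-- The vertices that do not share their column with a vertex of `γ`. -/
def offCols (γ : List V) : Set V := {v | ∀ g ∈ γ, D.col g ≠ D.col v}

open Classical in
variable (D) in
/-- The local modification in the column `z` that joins the path `γ` to the vertex `w`, through its
neighbour `w'` in the column `z`. Among the edges that meet the column, it opens those of `γ`, the
edge `w'w` and those inside the column that do not join two vertices of `γ`, and closes the others.
The vertices of `γ` in the column prefer their successor on `γ`. -/
noncomputable def surgery (η : State V) (γ : List V) (z : P) (w w' : V) : State V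
  | .inl e => if e ∈ D.G.edgeSet ∧ ∃ v ∈ e, D.col v = z then
      decide ((∃ a b, [a, b] <:+: γ ∧ e = s(a, b)) ∨ e = s(w', w) ∨
        ((∀ v ∈ e, D.col v = z) ∧ ∃ v ∈ e, v ∉ γ)) else η (.inl e)
  | .inr (v, x) => if D.col v = z ∧ D.G.Adj v x then decide ([v, x] <:+: γ) else η (.inr (v, x))

variable {z : P} {w w' : V}

lemma surgery_inl_iff {e : Sym2 V} (he : e ∈ D.G.edgeSet) (hz : ∃ v ∈ e, D.col v = z) :
    D.surgery η γ z w w' (.inl e) = true ↔ (∃ a b, [a, b] <:+: γ ∧ e = s(a, b)) ∨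
      e = s(w', w) ∨ ((∀ v ∈ e, D.col v = z) ∧ ∃ v ∈ e, v ∉ γ) := by
  simp only [surgery]
  rw [if_pos ⟨he, hz⟩]
  exact @decide_eq_true_iff _ (_)

lemma surgery_inr_iff {v x : V} (hz : D.col v = z) (hvx : D.G.Adj v x) :
    D.surgery η γ z w w' (.inr (v, x)) = true ↔ [v, x] <:+: γ := by
  simp only [surgery]
  rw [if_pos ⟨hz, hvx⟩]
  exact @decide_eq_true_iff _ (_)

lemma surgery_inr_of_col_ne {v x : V} (hz : D.col v ≠ z) :
    D.surgery η γ z w w' (.inr (v, x)) = η (.inr (v, x)) :=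
  if_neg fun h => hz h.1

lemma openAdj_surgery_iff_of_col_ne {v x : V} (hv : D.col v ≠ z) (hx : D.col x ≠ z) :
    D.OpenAdj (D.surgery η γ z w w') v x ↔ D.OpenAdj η v x := by
  have unchanged : D.surgery η γ z w w' (.inl s(v, x)) = η (.inl s(v, x)) :=
    if_neg (by simp [hv, hx])
  rw [OpenAdj, OpenAdj, unchanged]

lemma openAdj_surgery_of_col {v x : V} (ha : D.G.Adj v x) (hv : D.col v = z) (hx : D.col x = z)
    (hvγ : v ∉ γ) : D.OpenAdj (D.surgery η γ z w w') v x := by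
  refine ⟨ha, (surgery_inl_iff ha ⟨v, Sym2.mem_mk_left v x, hv⟩).2 (.inr (.inr ⟨?_, v, ?_, hvγ⟩))⟩
  · rintro u hu
    rcases Sym2.mem_iff.1 hu with rfl | rfl <;> assumption
  · exact Sym2.mem_mk_left v x

lemma openAdj_surgery_cases {v x : V} (h : D.OpenAdj (D.surgery η γ z w w') v x)
    (hz : D.col v = z ∨ D.col x = z) :
    ([v, x] <:+: γ ∨ [x, v] <:+: γ) ∨ (v = w' ∧ x = w ∨ v = w ∧ x = w') ∨
      (D.col v = z ∧ D.col x = z ∧ (v ∉ γ ∨ x ∉ γ)) := by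
  rcases (surgery_inl_iff h.1 (by simpa using hz)).1 h.2 with ⟨a, b, hab, e⟩ | e | hcol
  · rcases Sym2.eq_iff.1 e with ⟨rfl, rfl⟩ | ⟨rfl, rfl⟩
    · exact .inl (.inl hab)
    · exact .inl (.inr hab)
  · exact .inr (.inl (Sym2.eq_iff.1 e))
  · exact .inr (.inr (by simpa [and_assoc] using hcol))

lemma mem_of_pair_infix {a b : V} (hab : [a, b] <:+: γ) : a ∈ γ ∧ b ∈ γ :=
  ⟨hab.subset List.mem_cons_self, hab.subset (by simp)⟩

variable (D) in
/-- The vertices that the surgery attaches to `γ`: those of the column `z` outside `γ`, and the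
cluster of `S'`. -/
def attached (η : State V) (γ : List V) (z : P) : Set V :=
  {v | v ∉ γ ∧ D.col v = z} ∪ D.cluster η

variable [LinearOrder V]

variable (D) in
/-- `S` and `S'` are not connected in `η`, but the best crossing `γ` visits the column `z`, and the
edge from the vertex `w'` of that column to `w` would connect the column to `S'`. -/
structure IsGluingSite (η : State V) (γ : List V) (z : P) (w w' : V) : Prop where
  isMin : D.IsMin η γ
  not_joins : ¬ D.Joins η Set.univ D.S D.S'
  exists_mem : ∃ g ∈ γ, D.col g = z
  col_ne_of_mem_S : ∀ v ∈ D.S, D.col v ≠ z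
  adj : D.G.Adj w' w
  col_eq : D.col w' = z
  reachIn : ∃ s ∈ D.S', ReachIn (D.OpenAdj η) (D.offCols γ) s w

namespace IsGluingSite

variable (h : D.IsGluingSite η γ z w w')
include h

lemma notMem_cluster_of_mem_S {x : V} (hx : x ∈ D.S) : x ∉ D.cluster η := fun ⟨s, hs, hsx⟩ =>
  h.not_joins ⟨x, hx, s, hs, hsx.symm⟩

lemma notMem_cluster {x : V} (hx : x ∈ γ) : x ∉ D.cluster η := fun ⟨s, hs, hsx⟩ =>
  have ⟨a, ha, hax⟩ := h.isMin.1.reachIn hx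
  h.not_joins ⟨a, ha, s, hs, hax.trans hsx.symm⟩

lemma w_mem_cluster : w ∈ D.cluster η := h.reachIn.imp fun _ hs =>
  ⟨hs.1, hs.2.mono (fun _ _ _ _ h => h) (Set.subset_univ _)⟩

lemma col_ne_of_mem_offCols {v : V} (hv : v ∈ D.offCols γ) : D.col v ≠ z := by
  obtain ⟨g, hg, rfl⟩ := h.exists_mem
  exact (hv g hg).symm

lemma notMem_attached {v : V} (hv : v ∈ γ) : v ∉ D.attached η γ z := by
  rintro (hcol | hcluster)
  · exact hcol.1 hv
  · exact h.notMem_cluster hv hcluster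

lemma openAdj_of_surgery {v x : V} (hvx : D.OpenAdj (D.surgery η γ z w w') v x)
    (hv : v ∉ D.attached η γ z) (hx : x ∉ D.attached η γ z) : D.OpenAdj η v x := by
  by_cases hz : D.col v = z ∨ D.col x = z
  · rcases openAdj_surgery_cases hvx hz with
      (hi | hi) | (⟨rfl, rfl⟩ | ⟨rfl, rfl⟩) | ⟨hvz, hxz, hvγ | hxγ⟩
    · exact (rel_of_pair_infix h.isMin.1.isChain hi).1
    · exact Std.Symm.symm _ _ (rel_of_pair_infix h.isMin.1.isChain hi).1
    · exact (hx (.inr h.w_mem_cluster)).elim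
    · exact (hv (.inr h.w_mem_cluster)).elim
    · exact (hv (.inl ⟨hvγ, hvz⟩)).elim
    · exact (hx (.inl ⟨hxγ, hxz⟩)).elim
  · rw [not_or] at hz
    exact (openAdj_surgery_iff_of_col_ne hz.1 hz.2).1 hvx

lemma notMem_attached_of_openAdj_surgery {v x : V} (hv : v ∉ D.attached η γ z)
    (hvz : D.col v ≠ z) (hvx : D.OpenAdj (D.surgery η γ z w w') v x) :
    x ∉ D.attached η γ z := by
  have hvw : v ≠ w := fun e => hv (.inr (e ▸ h.w_mem_cluster))
  rintro hx
  by_cases hxz : D.col x = z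
  · rcases openAdj_surgery_cases hvx (.inr hxz) with
      (hi | hi) | (⟨rfl, -⟩ | ⟨rfl, -⟩) | ⟨hvz', -⟩
    · exact h.notMem_attached (mem_of_pair_infix hi).2 hx
    · exact h.notMem_attached (mem_of_pair_infix hi).1 hx
    · exact hvz h.col_eq
    · exact hvw rfl
    · exact hvz hvz'
  · have hvx' := (openAdj_surgery_iff_of_col_ne hvz hxz).1 hvx
    exact hv (.inr (mem_cluster_of_openAdj (hx.resolve_left fun h => hxz h.2)
      (Std.Symm.symm _ _ hvx')))

lemma openAdj_surgery_of_pair_infix {a b : V} (hab : [a, b] <:+: γ) :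
    D.OpenAdj (D.surgery η γ z w w') a b := by
  have hopen := (rel_of_pair_infix h.isMin.1.isChain hab).1
  by_cases hz : D.col a = z ∨ D.col b = z
  · exact ⟨hopen.1, (surgery_inl_iff hopen.1 (by simpa using hz)).2 (.inl ⟨a, b, hab, rfl⟩)⟩
  · rw [not_or] at hz
    exact (openAdj_surgery_iff_of_col_ne hz.1 hz.2).2 hopen

lemma openAdj_surgery_bridge : D.OpenAdj (D.surgery η γ z w w') w' w :=
  ⟨h.adj, (surgery_inl_iff h.adj ⟨w', Sym2.mem_mk_left w' w, h.col_eq⟩).2 (.inr (.inl rfl))⟩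

lemma isCrossing_surgery : D.IsCrossing (D.surgery η γ z w w') γ where
  isChain := by
    rw [List.isChain_iff_forall_rel_of_append_cons_cons]
    intro a b l₁ l₂ e
    have hab : [a, b] <:+: γ := ⟨l₁, l₂, by simp [e]⟩
    exact ⟨h.openAdj_surgery_of_pair_infix hab, (rel_of_pair_infix h.isMin.1.isChain hab).2⟩
  nodup := h.isMin.1.nodup
  head := h.isMin.1.head
  last := h.isMin.1.last

lemma isCrossing_of_surgery {σ : List V} (hσ : D.IsCrossing (D.surgery η γ z w w') σ)
    (hn : ∀ v ∈ σ, v ∉ D.attached η γ z) : D.IsCrossing η σ where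
  isChain := hσ.isChain.imp_of_mem_imp fun _ _ hv hx hstep =>
    ⟨h.openAdj_of_surgery hstep.1 (hn _ hv) (hn _ hx), hstep.2⟩
  nodup := hσ.nodup
  head := hσ.head
  last := hσ.last

lemma notMem_attached_of_isChain {l : List V} (hl : l.IsChain (D.Step (D.surgery η γ z w w')))
    (hlγ : ∀ v ∈ l, v ∉ γ) (hhead : ∀ x ∈ l.head?, x ∉ D.attached η γ z) :
    ∀ v ∈ l, v ∉ D.attached η γ z := by
  have hl' : l.IsChain fun v x => v ∉ γ ∧ D.Step (D.surgery η γ z w w') v x :=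
    hl.imp_of_mem_imp fun v _ hv _ hstep => ⟨hlγ v hv, hstep⟩
  refine hl'.induction (· ∉ D.attached η γ z) l (fun v x hstep hv => ?_) fun hne =>
    hhead _ (List.head?_eq_some_head hne)
  exact h.notMem_attached_of_openAdj_surgery hv (fun hvz => hv (.inl ⟨hstep.1, hvz⟩)) hstep.2.1

section Branch

variable {l s g : List V} {x y : V} (hγ : γ = l ++ y :: g)
  (hσ : D.IsCrossing (D.surgery η γ z w w') (l ++ x :: s))
  (hlt : prio (D.surgery η γ z w w') l.getLast? x < prio (D.surgery η γ z w w') l.getLast? y)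
include hγ hσ hlt

/-- In the column `z` the surgery makes `γ` follow its preferences. -/
lemma col_ne_of_branch {u : V} (hu : u ∈ l.getLast?) : D.col u ≠ z := by
  intro huz
  obtain ⟨l, rfl⟩ := List.getLast?_eq_some_iff.1 hu
  have huy : [u, y] <:+: γ := ⟨l, g, by simp [hγ]⟩
  have adj_x : D.G.Adj u x := (rel_of_pair_infix hσ.isChain ⟨l, s, by simp⟩).1.1
  have adj_y : D.G.Adj u y := (rel_of_pair_infix h.isMin.1.isChain huy).1.1
  have not_infix : ¬ [u, x] <:+: γ := fun hux =>
    hlt.ne (by rw [eq_of_pair_infix_of_nodup h.isMin.1.nodup hux huy])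
  have prefers_y : D.surgery η γ z w w' (.inr (u, y)) = true := (surgery_inr_iff huz adj_y).2 huy
  have not_prefers_x : D.surgery η γ z w w' (.inr (u, x)) = false :=
    Bool.eq_false_iff.2 (mt (surgery_inr_iff huz adj_x).1 not_infix)
  refine hlt.not_gt (Prod.Lex.lt_iff.2 (.inl ?_))
  simp [prio, prefers_y, not_prefers_x]

lemma prio_lt_of_branch : prio η l.getLast? x < prio η l.getLast? y := by
  have prio_eq (v : V) :
      prio (D.surgery η γ z w w') l.getLast? v = prio η l.getLast? v :=
    prio_congr fun u hu => surgery_inr_of_col_ne (h.col_ne_of_branch hγ hσ hlt hu)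
  rwa [prio_eq, prio_eq] at hlt

lemma notMem_attached_of_branch : x ∉ D.attached η γ z := by
  rcases List.eq_nil_or_concat l with rfl | ⟨l, u, rfl⟩
  · obtain ⟨a, ha, haS, -⟩ := hσ.head
    obtain rfl : x = a := Option.some_inj.1 ha
    rintro (hcol | hcluster)
    · exact h.col_ne_of_mem_S x haS hcol.2
    · exact h.notMem_cluster_of_mem_S haS hcluster
  · refine h.notMem_attached_of_openAdj_surgery (v := u) (h.notMem_attached (by simp [hγ]))
      (h.col_ne_of_branch hγ hσ hlt (by simp)) ?_
    exact (rel_of_pair_infix hσ.isChain ⟨l, s, by simp⟩).1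

omit hlt in
/-- A branch avoiding the attached vertices as long as it stays off `γ` yields a crossing that was
already open before the surgery: follow the branch up to its first return to `γ`, and `γ` from
there on. -/
lemma exists_isCrossing_of_branch (hx : x ∉ D.attached η γ z) :
    ∃ s', D.IsCrossing η (l ++ x :: s') := by
  classical
  have prefix_notMem (v) (hv : v ∈ l) : v ∉ D.attached η γ z :=
    h.notMem_attached (by simp [hγ, hv])
  have off_notMem (r) (hr : r <+: x :: s) (hrγ : ∀ v ∈ r, v ∉ γ) :
      ∀ v ∈ r, v ∉ D.attached η γ z :=
    h.notMem_attached_of_isChain (hσ.isChain.right_of_append.prefix hr) hrγ fun v hv => by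
      obtain ⟨t, ht⟩ := hr
      have heads_eq := congrArg List.head? ht
      rw [List.head?_append, Option.mem_def.1 hv] at heads_eq
      exact Option.some_inj.1 heads_eq ▸ hx
  rcases hfind : (x :: s).find? (· ∈ γ) with _ | b
  · have hsγ : ∀ v ∈ x :: s, v ∉ γ := by
      simpa only [List.find?_eq_none, decide_eq_true_iff] using hfind
    exact ⟨s, h.isCrossing_of_surgery hσ
      (List.forall_mem_append.2 ⟨prefix_notMem, off_notMem _ List.prefix_rfl hsγ⟩)⟩
  obtain ⟨hb, r, t, e, hr⟩ := List.find?_eq_some_iff_append.1 hfind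
  simp only [decide_eq_true_iff, Bool.not_eq_true', decide_eq_false_iff_not] at hb hr
  rw [e, ← List.append_assoc] at hσ
  have hbl : b ∉ l := fun hbl =>
    hσ.nodup.disjoint (List.mem_append_left r hbl) List.mem_cons_self
  obtain ⟨g₁, g₂, hg⟩ := List.append_of_mem
    ((List.mem_append.1 (hγ ▸ hb : b ∈ l ++ y :: g)).resolve_left hbl)
  rw [hg, ← List.append_assoc] at hγ
  have disjoint_rest : (l ++ r).Disjoint (b :: g₂) := by
    refine List.disjoint_append_left.2 ⟨?_, fun v hv hv' => hr v hv (by simp [hγ, hv'])⟩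
    exact List.disjoint_of_disjoint_append_left_left (hγ ▸ h.isMin.1.nodup).disjoint
  have hspliced := hσ.splice (p' := l ++ g₁) (by rw [← hγ]; exact h.isCrossing_surgery)
    disjoint_rest
  obtain ⟨s', hs'⟩ : ∃ s', r ++ b :: g₂ = x :: s' := by
    rcases r with _ | ⟨a, r⟩
    · exact ⟨g₂, by rw [(List.cons.inj e).1]; rfl⟩
    · exact ⟨r ++ b :: g₂, by rw [(List.cons.inj e).1]; rfl⟩
  refine ⟨s', ?_⟩
  rw [← hs', ← List.append_assoc]
  refine h.isCrossing_of_surgery hspliced (List.forall_mem_append.2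
    ⟨List.forall_mem_append.2 ⟨prefix_notMem, off_notMem r ⟨b :: t, e.symm⟩ hr⟩, fun v hv => ?_⟩)
  exact h.notMem_attached (hγ ▸ List.mem_append_right _ hv)

end Branch

lemma isMin_surgery : D.IsMin (D.surgery η γ z w w') γ := by
  refine ⟨h.isCrossing_surgery, fun l x y s g hγ hσ => ?_⟩
  by_contra! hlt
  obtain ⟨s', hσ'⟩ := h.exists_isCrossing_of_branch hγ hσ (h.notMem_attached_of_branch hγ hσ hlt)
  exact (h.prio_lt_of_branch hγ hσ hlt).not_ge (h.isMin.2 l x y s' g hγ hσ')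

end IsGluingSite

end Surgery

section Contacts

variable (D) in
/-- The vertex `g` is joined by an open edge to a vertex connected to `S'` off `γ`. -/
def Touches (η : State V) (γ : List V) (g : V) : Prop :=
  ∃ x, D.OpenAdj η g x ∧ ∃ s ∈ D.S', ReachIn (D.OpenAdj η) {v | v ∉ γ} s x

open Classical in
variable (D) in
/-- The columns of the vertices of `γ` that touch the cluster of `S'`. -/
noncomputable def contacts (η : State V) (γ : List V) : Finset P :=
  (γ.filter fun g => D.Touches η γ g).toFinset.image D.col

open Classical in
variable (D) in
/-- The columns of `γ` next to a vertex that is connected to `S'` in `B'` off the columns of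
`γ`: this is where the gluing surgery is possible. -/
noncomputable def candidates (η : State V) (γ : List V) : Finset P :=
  (γ.toFinset.image D.col).filter fun z => ∃ w w', D.G.Adj w' w ∧ D.col w' = z ∧
    ∃ s ∈ D.S', ReachIn (D.OpenAdj η) (D.B' ∩ D.offCols γ) s w

lemma mem_contacts {z : P} :
    z ∈ D.contacts η γ ↔ ∃ g ∈ γ, D.Touches η γ g ∧ D.col g = z := by
  simp [contacts, and_assoc]

lemma mem_candidates {z : P} :
    z ∈ D.candidates η γ ↔ (∃ g ∈ γ, D.col g = z) ∧ ∃ w w', D.G.Adj w' w ∧ D.col w' = z ∧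
      ∃ s ∈ D.S', ReachIn (D.OpenAdj η) (D.B' ∩ D.offCols γ) s w := by
  simp [candidates]

end Contacts

variable (D) in
/-- The geometric input of the gluing argument: `S` and `S'` are unions of columns, columns are
connected, and two paths in `B'` from `S'` to `Yminus` and to `Yplus` cannot both avoid the columns
of a path in `B` from `S` to `Z` that does not meet `S'`. -/
structure IsSeparating : Prop where
  mem_S : ∀ v x, D.col v = D.col x → v ∈ D.S → x ∈ D.S
  mem_S' : ∀ v x, D.col v = D.col x → v ∈ D.S' → x ∈ D.S'
  column_connected : ∀ v x, D.col v = D.col x → ReachIn D.G.Adj {u | D.col u = D.col v} v x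
  separates : ∀ γ : List V, γ.IsChain D.G.Adj → (∀ v ∈ γ, v ∈ D.B) →
    (∃ a ∈ γ.head?, a ∈ D.S) → (∃ b ∈ γ.getLast?, b ∈ D.Z) → (∀ v ∈ γ, v ∉ D.S') →
    ∀ s₁ ∈ D.S', ∀ s₂ ∈ D.S', ∀ y₁ ∈ D.Yminus, ∀ y₂ ∈ D.Yplus,
      ReachIn D.G.Adj (D.B' ∩ D.offCols γ) s₁ y₁ →
      ¬ ReachIn D.G.Adj (D.B' ∩ D.offCols γ) s₂ y₂

namespace IsGluingSite

variable {z : P} {w w' : V} [LinearOrder V] (h : D.IsGluingSite η γ z w w')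
include h

lemma col_eq_of_touches {g : V} (hg : g ∈ γ) (ht : D.Touches (D.surgery η γ z w w') γ g) :
    D.col g = z := by
  obtain ⟨x, hgx, s, hs, hsx⟩ := ht
  have hx : x ∈ D.attached η γ z := by
    refine hsx.propagates (p := (· ∈ D.attached η γ z)) (.inr ⟨s, hs, .refl trivial⟩) ?_
    intro a _ b hb hab ha
    by_contra hb'
    refine h.notMem_attached_of_openAdj_surgery hb' ?_ (Std.Symm.symm _ _ hab) ha
    exact fun hbz => hb' (.inl ⟨hb, hbz⟩)
  by_contra hgz
  exact h.notMem_attached_of_openAdj_surgery (h.notMem_attached hg) hgz hgx hx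

/-- Follow the path from `S'` to `w`, the edge from `w` to `w'` and then the column, up to the first
vertex of `γ`. -/
lemma exists_touches
    (hcol : ∀ v x, D.col v = D.col x → ReachIn D.G.Adj {u | D.col u = D.col v} v x) :
    ∃ g ∈ γ, D.Touches (D.surgery η γ z w w') γ g ∧ D.col g = z := by
  obtain ⟨s, hs, hsw⟩ := h.reachIn
  have reach_w : ReachIn (D.OpenAdj (D.surgery η γ z w w')) {v | v ∉ γ} s w := by
    refine hsw.mono (fun a ha b hb hab => ?_) fun a ha haγ => ha a haγ rfl
    rwa [openAdj_surgery_iff_of_col_ne (h.col_ne_of_mem_offCols ha) (h.col_ne_of_mem_offCols hb)]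
  obtain ⟨g₀, hg₀, hg₀z⟩ := h.exists_mem
  have reach_g₀ := hcol w' g₀ (by rw [h.col_eq, hg₀z])
  rw [h.col_eq] at reach_g₀
  suffices ReachIn (D.OpenAdj (D.surgery η γ z w w')) {v | v ∉ γ} s g₀ ∨
      ∃ g ∈ γ, D.Touches (D.surgery η γ z w w') γ g ∧ D.col g = z from
    this.resolve_left fun h' => h'.right_mem hg₀
  refine reach_g₀.propagates (p := fun v =>
    ReachIn (D.OpenAdj (D.surgery η γ z w w')) {v | v ∉ γ} s v ∨ _) ?_ ?_
  · by_cases hw' : w' ∈ γ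
    · exact .inr ⟨w', hw', ⟨w, h.openAdj_surgery_bridge, s, hs, reach_w⟩, h.col_eq⟩
    · exact .inl (reach_w.tail (Std.Symm.symm _ _ h.openAdj_surgery_bridge) hw')
  · rintro a ha b hb hab (hsa | hdone)
    · have hab' : D.OpenAdj (D.surgery η γ z w w') a b :=
        openAdj_surgery_of_col hab ha hb hsa.right_mem
      by_cases hbγ : b ∈ γ
      · exact .inr ⟨b, hbγ, ⟨a, Std.Symm.symm _ _ hab', s, hs, hsa⟩, hb⟩
      · exact .inl (hsa.tail hab' hbγ)
    · exact .inr hdone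

lemma contacts_surgery
    (hcol : ∀ v x, D.col v = D.col x → ReachIn D.G.Adj {u | D.col u = D.col v} v x) :
    D.contacts (D.surgery η γ z w w') (D.minPath (D.surgery η γ z w w')) = {z} := by
  rw [h.isMin_surgery.minPath_eq]
  ext z'
  rw [mem_contacts, Finset.mem_singleton]
  constructor
  · rintro ⟨g, hg, ht, rfl⟩
    exact h.col_eq_of_touches hg ht
  · rintro rfl
    exact h.exists_touches hcol

end IsGluingSite

lemma isGluingSite_of_mem_candidates [LinearOrder V] (hD : D.IsSeparating) (h : D.IsMin η γ)
    (hη : ¬ D.Joins η Set.univ D.S D.S') {a : V} (ha : a ∈ γ.head?) {z : P} (hza : z ≠ D.col a)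
    (hz : z ∈ D.candidates η γ) : ∃ w w', D.IsGluingSite η γ z w w' := by
  obtain ⟨⟨g, hg, hgz⟩, w, w', hadj, hw', s, hs, hsw⟩ := mem_candidates.1 hz
  refine ⟨w, w', h, hη, ⟨g, hg, hgz⟩, fun v hv hvz => ?_, hadj, hw', s, hs,
    hsw.mono (fun _ _ _ _ h => h) Set.inter_subset_right⟩
  have hgS : g ∈ D.S := hD.mem_S v g (hvz.trans hgz.symm) hv
  obtain ⟨l₁, l₂, rfl⟩ := List.append_of_mem hg
  refine h.1.notMem_S (fun hl₁ => hza ?_) hgS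
  obtain rfl : g = a := by simpa [hl₁] using ha
  exact hgz.symm

section Cutting

open Classical in
variable (D) in
/-- Close the edges meeting the columns in `U` other than those of `γ`. -/
noncomputable def cutting (η : State V) (γ : List V) (U : Finset P) : State V
  | .inl e => η (.inl e) && decide (e ∈ D.G.edgeSet → (∃ v ∈ e, D.col v ∈ U) →
      ∃ a b, [a, b] <:+: γ ∧ e = s(a, b))
  | .inr d => η (.inr d)

variable {U : Finset P}

lemma cutting_inl_iff {e : Sym2 V} :
    D.cutting η γ U (.inl e) = true ↔ η (.inl e) = true ∧
      (e ∈ D.G.edgeSet → (∃ v ∈ e, D.col v ∈ U) → ∃ a b, [a, b] <:+: γ ∧ e = s(a, b)) := by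
  rw [cutting, Bool.and_eq_true]
  exact and_congr_right fun _ => @decide_eq_true_iff _ (_)

lemma openAdj_cutting_iff (hU : ∀ z ∈ U, ∃ g ∈ γ, D.col g = z) {v x : V}
    (hv : v ∈ D.offCols γ) (hx : x ∈ D.offCols γ) :
    D.OpenAdj (D.cutting η γ U) v x ↔ D.OpenAdj η v x := by
  have notMem_U {u : V} (hu : u ∈ s(v, x)) : D.col u ∉ U := fun huU => by
    obtain ⟨g, hg, hgu⟩ := hU _ huU
    rcases Sym2.mem_iff.1 hu with rfl | rfl
    · exact hv g hg hgu
    · exact hx g hg hgu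
  rw [OpenAdj, OpenAdj, cutting_inl_iff]
  exact and_congr_right fun _ =>
    and_iff_left fun _ ⟨u, hu, huU⟩ => (notMem_U hu huU).elim

lemma candidates_cutting (hU : ∀ z ∈ U, ∃ g ∈ γ, D.col g = z) :
    D.candidates (D.cutting η γ U) γ = D.candidates η γ := by
  ext z
  rw [mem_candidates, mem_candidates]
  refine and_congr_right fun _ => exists_congr fun w => exists_congr fun w' =>
    and_congr_right fun _ => and_congr_right fun _ => exists_congr fun s =>
    and_congr_right fun _ => ⟨fun h => ?_, fun h => ?_⟩
  · exact h.mono (fun a ha b hb hab => (openAdj_cutting_iff hU ha.2 hb.2).1 hab) subset_rfl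
  · exact h.mono (fun a ha b hb hab => (openAdj_cutting_iff hU ha.2 hb.2).2 hab) subset_rfl

lemma reachIn_of_cutting_candidates {s y : V} (hs : s ∈ D.S') (hsγ : s ∈ D.offCols γ)
    (hy : ReachIn (D.OpenAdj (D.cutting η γ (D.candidates η γ))) D.B' s y) :
    ReachIn (D.OpenAdj η) (D.B' ∩ D.offCols γ) s y := by
  refine hy.propagates (.refl ⟨hy.left_mem, hsγ⟩) fun a _ b hb hab ha => ?_
  obtain ⟨hopen, hcut⟩ := cutting_inl_iff.1 hab.2
  refine ha.tail ⟨hab.1, hopen⟩ ⟨hb, fun g hg e => ?_⟩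
  have hz : D.col b ∈ D.candidates η γ :=
    mem_candidates.2 ⟨⟨g, hg, e⟩, a, b, hab.1.symm, rfl, s, hs, ha⟩
  obtain ⟨u, v, huv, hab'⟩ := hcut hab.1 ⟨b, Sym2.mem_mk_right a b, hz⟩
  have haγ : a ∈ γ := by
    rcases Sym2.mem_iff.1 (hab' ▸ Sym2.mem_mk_left a b) with rfl | rfl
    · exact (mem_of_pair_infix huv).1
    · exact (mem_of_pair_infix huv).2
  exact ha.right_mem.2 a haγ rfl

variable (D) in
/-- The three open paths assumed by the gluing lemma are present. -/
def HasArms (η : State V) : Prop :=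
  D.Joins η D.B D.S D.Z ∧ D.Joins η D.B' D.S' D.Yminus ∧ D.Joins η D.B' D.S' D.Yplus

variable [LinearOrder V]

lemma isMin_cutting (h : D.IsMin η γ) (U : Finset P) : D.IsMin (D.cutting η γ U) γ :=
  h.of_closing_edges (fun _ he => (cutting_inl_iff.1 he).1) (fun _ => rfl) fun a b hab =>
    cutting_inl_iff.2 ⟨(rel_of_pair_infix h.1.isChain hab).1.2, fun _ _ => ⟨a, b, hab, rfl⟩⟩

lemma not_hasArms_cutting (hD : D.IsSeparating) (h : D.IsMin η γ)
    (hη : ¬ D.Joins η Set.univ D.S D.S') :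
    ¬ D.HasArms (D.cutting η γ (D.candidates η γ)) := by
  rintro ⟨-, ⟨s₁, hs₁, y₁, hy₁, h₁⟩, s₂, hs₂, y₂, hy₂, h₂⟩
  have γ_avoids_S' (v) (hv : v ∈ γ) : v ∉ D.S' := fun hvS => by
    obtain ⟨a, ha, hav⟩ := h.1.reachIn hv
    exact hη ⟨a, ha, v, hvS, hav⟩
  have mem_offCols {s} (hs : s ∈ D.S') : s ∈ D.offCols γ := fun g hg e =>
    γ_avoids_S' g hg (hD.mem_S' s g e.symm hs)
  have reach_off {s y} (hs : s ∈ D.S')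
      (hy : ReachIn (D.OpenAdj (D.cutting η γ (D.candidates η γ))) D.B' s y) :
      ReachIn D.G.Adj (D.B' ∩ D.offCols γ) s y :=
    (reachIn_of_cutting_candidates hs (mem_offCols hs) hy).mono (fun _ _ _ _ h => h.1) subset_rfl
  exact hD.separates γ (h.1.isChain.imp fun _ _ h => h.1.1) (fun v hv => h.1.mem_B hv)
    (h.1.head.imp fun _ ha => ⟨ha.1, ha.2.1⟩) h.1.last γ_avoids_S'
    s₁ hs₁ s₂ hs₂ y₁ hy₁ y₂ hy₂ (reach_off hs₁ h₁) (reach_off hs₂ h₂)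

end Cutting

section Probability

variable [Fintype V]

open Classical in
variable (D) in
/-- The coordinates of the edges meeting the column `z` and of the ordered pairs of neighbours
starting in it: the only ones that a modification in this column may change. -/
noncomputable def star (z : P) : Finset (Coord V) :=
  Finset.univ.filter fun i => i.elim (fun e => e ∈ D.G.edgeSet ∧ ∃ v ∈ e, D.col v = z)
    fun d => D.col d.1 = z ∧ D.G.Adj d.1 d.2

lemma inl_mem_star {z : P} {e : Sym2 V} :
    (.inl e : Coord V) ∈ D.star z ↔ e ∈ D.G.edgeSet ∧ ∃ v ∈ e, D.col v = z := by
  simp [star]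

lemma inr_mem_star {z : P} {v x : V} :
    (.inr (v, x) : Coord V) ∈ D.star z ↔ D.col v = z ∧ D.G.Adj v x := by
  simp [star]

lemma surgery_apply_of_notMem_star {z : P} {w w' : V} {i : Coord V} (hi : i ∉ D.star z) :
    D.surgery η γ z w w' i = η i := by
  rcases i with e | ⟨v, x⟩
  · rw [inl_mem_star] at hi
    simp only [surgery, if_neg hi]
  · rw [inr_mem_star] at hi
    simp only [surgery, if_neg hi]

lemma cutting_apply_of_notMem_star {U : Finset P} {i : Coord V} (hi : ∀ z ∈ U, i ∉ D.star z) :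
    D.cutting η γ U i = η i := by
  rcases i with e | d
  · rw [Bool.eq_iff_iff, cutting_inl_iff]
    refine and_iff_left fun he ⟨v, hv, hvU⟩ => (hi _ hvU ?_).elim
    exact inl_mem_star.2 ⟨he, v, hv, rfl⟩
  · rfl

variable [LinearOrder V] {μ : Measure Bool} [IsProbabilityMeasure μ] {m : ℝ} (hm : 0 < m)
  (hμ : ∀ b, m ≤ μ.real {b}) {M : ℕ} (hM : ∀ z, (D.star z).card ≤ M) (hD : D.IsSeparating) (t : ℕ)
include hm hμ hM hD

/-- Closing the few edges around the candidate columns destroys the arms. -/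
lemma real_few_candidates_le :
    (iidMeasure (Coord V) μ).real {η | D.HasArms η ∧ ¬ D.Joins η Set.univ D.S D.S' ∧
      (D.candidates η (D.minPath η)).card ≤ t} ≤
    (2 * m⁻¹) ^ (t * M) * (iidMeasure (Coord V) μ).real {η | ¬ D.HasArms η} := by
  classical
  have modification_bound := mul_iidMeasure_real_le_of_modification hm hμ (s := t * M) (t := 1)
    (A := {η | D.HasArms η ∧ ¬ D.Joins η Set.univ D.S D.S' ∧
      (D.candidates η (D.minPath η)).card ≤ t})
    (D := {η | ¬ D.HasArms η ∧ (D.candidates η (D.minPath η)).card ≤ t})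
    (fun η => (D.candidates η (D.minPath η)).biUnion D.star)
    (fun η hη => (Finset.card_biUnion_le_card_mul _ _ _ fun z _ => hM z).trans
      (Nat.mul_le_mul_right _ hη.2)) ?_
  · simp only [Nat.cast_one, one_mul, Nat.card_eq_fintype_card, Fintype.card_bool,
      Nat.cast_ofNat] at modification_bound
    refine modification_bound.trans (mul_le_mul_of_nonneg_left ?_ (by positivity))
    exact measureReal_mono fun η hη => hη.1
  · rintro η ⟨harms, hη, hcard⟩
    obtain ⟨γ, hγ⟩ := exists_isMin harms.1
    rw [hγ.minPath_eq] at hcard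
    refine ⟨{D.cutting η γ (D.candidates η γ)}, by simp, fun η' hη' => ?_⟩
    obtain rfl := Finset.mem_singleton.1 hη'
    have candidates_eq : D.candidates (D.cutting η γ (D.candidates η γ)) γ = D.candidates η γ :=
      candidates_cutting fun z hz => (mem_candidates.1 hz).1
    simp only [(isMin_cutting hγ _).minPath_eq, candidates_eq, Set.mem_ofPred_eq,
      Finset.mem_biUnion, not_exists, not_and]
    exact ⟨⟨not_hasArms_cutting hD hγ hη, hcard⟩,
      fun i hi => (cutting_apply_of_notMem_star hi).symm⟩

/-- Each candidate column, except possibly the one where the path starts, allows a surgery, and the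
column is recovered from the outcome as the only contact. -/
lemma mul_real_many_candidates_le :
    t * (iidMeasure (Coord V) μ).real {η | D.HasArms η ∧ ¬ D.Joins η Set.univ D.S D.S' ∧
      t < (D.candidates η (D.minPath η)).card} ≤ (2 * m⁻¹) ^ M := by
  classical
  have modification_bound := mul_iidMeasure_real_le_of_modification hm hμ (s := M) (t := t)
    (A := {η | D.HasArms η ∧ ¬ D.Joins η Set.univ D.S D.S' ∧
      t < (D.candidates η (D.minPath η)).card})
    (D := {η | (D.contacts η (D.minPath η)).card ≤ 1})
    (fun η => (D.contacts η (D.minPath η)).biUnion D.star)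
    (fun η hη => (Finset.card_biUnion_le_card_mul _ _ _ fun z _ => hM z).trans
      (by simpa using Nat.mul_le_mul_right M hη)) ?_
  · simp only [Nat.card_eq_fintype_card, Fintype.card_bool, Nat.cast_ofNat] at modification_bound
    exact modification_bound.trans (mul_le_of_le_one_right (by positivity) measureReal_le_one)
  · rintro η ⟨harms, hη, hcard⟩
    obtain ⟨γ, hγ⟩ := exists_isMin harms.1
    rw [hγ.minPath_eq] at hcard
    obtain ⟨a, ha, -⟩ := hγ.1.head
    have : Nonempty V := ⟨a⟩
    have site (z) (hz : z ∈ (D.candidates η γ).erase (D.col a)) :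
        ∃ w w', D.IsGluingSite η γ z w w' :=
      isGluingSite_of_mem_candidates hD hγ hη ha (Finset.mem_erase.1 hz).1 (Finset.mem_erase.1 hz).2
    choose! w w' hsite using site
    have contacts_eq (z) (hz : z ∈ (D.candidates η γ).erase (D.col a)) :=
      (hsite z hz).contacts_surgery hD.column_connected
    refine ⟨((D.candidates η γ).erase (D.col a)).image fun z => D.surgery η γ z (w z) (w' z), ?_,
      Finset.forall_mem_image.2 fun z hz => ?_⟩
    · rw [Finset.card_image_of_injOn fun z hz z' hz' e => ?_]
      · have := Finset.pred_card_le_card_erase (s := D.candidates η γ) (a := D.col a)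
        omega
      · rw [← Finset.singleton_inj, ← contacts_eq z hz, ← contacts_eq z' hz']
        exact congrArg (fun η => D.contacts η (D.minPath η)) e
    · simp only [contacts_eq z hz, Set.mem_ofPred_eq, Finset.card_singleton, le_refl, true_and,
        Finset.singleton_biUnion]
      exact fun i hi => (surgery_apply_of_notMem_star hi).symm

theorem real_not_joins_le (ht : 0 < t) :
    (iidMeasure (Coord V) μ).real {η | ¬ D.Joins η Set.univ D.S D.S'} ≤
      (1 + (2 * m⁻¹) ^ (t * M)) * (iidMeasure (Coord V) μ).real {η | ¬ D.HasArms η} +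
        (2 * m⁻¹) ^ M / t := by
  have few := real_few_candidates_le hm hμ hM hD t
  have many := mul_real_many_candidates_le hm hμ hM hD t
  rw [mul_comm, ← le_div_iff₀ (by exact_mod_cast ht)] at many
  have cover : {η | ¬ D.Joins η Set.univ D.S D.S'} ⊆ {η | ¬ D.HasArms η} ∪
      ({η | D.HasArms η ∧ ¬ D.Joins η Set.univ D.S D.S' ∧
          (D.candidates η (D.minPath η)).card ≤ t} ∪
        {η | D.HasArms η ∧ ¬ D.Joins η Set.univ D.S D.S' ∧
          t < (D.candidates η (D.minPath η)).card}) := by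
    intro η hη
    by_cases harms : D.HasArms η
    · rcases le_or_gt (D.candidates η (D.minPath η)).card t with hcard | hcard
      · exact .inr (.inl ⟨harms, hη, hcard⟩)
      · exact .inr (.inr ⟨harms, hη, hcard⟩)
    · exact .inl harms
  have union_bound := (measureReal_mono (μ := iidMeasure (Coord V) μ) cover).trans
    ((measureReal_union_le _ _).trans (add_le_add_right (measureReal_union_le _ _) _))
  linarith

end Probability

end GluingData

section PlanarPaths

/-- Points of `ℤ²` at `ℓ¹`-distance at most one. -/
def PlanarStep (v w : ℤ × ℤ) : Prop := |v.1 - w.1| + |v.2 - w.2| ≤ 1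

lemma planarStep_cases {v w : ℤ × ℤ} (h : PlanarStep v w) :
    v = w ∨ (w.1 = v.1 + 1 ∧ w.2 = v.2) ∨ (v.1 = w.1 + 1 ∧ v.2 = w.2) ∨
      (w.2 = v.2 + 1 ∧ w.1 = v.1) ∨ (v.2 = w.2 + 1 ∧ v.1 = w.1) := by
  unfold PlanarStep at h
  rw [Prod.ext_iff]
  rcases abs_cases (v.1 - w.1) with ⟨h₁, _⟩ | ⟨h₁, _⟩ <;>
  rcases abs_cases (v.2 - w.2) with ⟨h₂, _⟩ | ⟨h₂, _⟩ <;> omega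

/-- The number, modulo 2, of crossings by the step `vw` of the horizontal half-line to the left of
`h`, the half-line being moved up by half a unit. -/
def crossing (h v w : ℤ × ℤ) : ZMod 2 :=
  if v.1 < h.1 then (if v.2 ≤ h.2 then 1 else 0) + (if w.2 ≤ h.2 then 1 else 0) else 0

lemma crossing_eq_of_right {v w h h' : ℤ × ℤ} (hvw : PlanarStep v w) (h₁ : h'.1 = h.1 + 1)
    (h₂ : h'.2 = h.2) (hv : v ≠ h) (hw : w ≠ h) : crossing h' v w = crossing h v w := by
  unfold crossing
  rw [h₁, h₂]
  rw [Ne, Prod.ext_iff] at hv hw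
  rcases planarStep_cases hvw with rfl | hvw | hvw | hvw | hvw <;> split_ifs <;>
    first | rfl | omega

lemma crossing_eq_of_up {v w h h' : ℤ × ℤ} (hvw : PlanarStep v w) (h₂ : h'.2 = h.2 + 1)
    (h₁ : h'.1 = h.1) (hv : v ≠ h') (hw : w ≠ h') : crossing h' v w = crossing h v w +
      ((if v.1 < h.1 ∧ v.2 = h.2 + 1 then 1 else 0) +
        (if w.1 < h.1 ∧ w.2 = h.2 + 1 then 1 else 0)) := by
  unfold crossing
  rw [Ne, Prod.ext_iff] at hv hw
  rw [h₁, h₂] at *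
  rcases planarStep_cases hvw with rfl | hvw | hvw | hvw | hvw <;> split_ifs <;>
    first | rfl | omega

lemma crossing_of_le {v w h : ℤ × ℤ} (hvw : PlanarStep v w) (hle : w.1 ≤ h.1)
    (hv : v ≠ h) (hw : w ≠ h) :
    crossing h v w = (if v.2 ≤ h.2 then 1 else 0) + (if w.2 ≤ h.2 then 1 else 0) := by
  unfold crossing
  rw [Ne, Prod.ext_iff] at hv hw
  rcases planarStep_cases hvw with rfl | hvw | hvw | hvw | hvw <;> split_ifs <;>
    first | rfl | omega

/-- `N h` behaves like the number, modulo 2, of crossings of the half-line to the left of `h` by a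
path from `a` to `b` that avoids `H` and stays in the strip `xl ≤ x ≤ xr`. -/
structure IsCrossingNumber (H : Set (ℤ × ℤ)) (xl xr : ℤ) (a b : ℤ × ℤ) (N : ℤ × ℤ → ZMod 2) :
    Prop where
  right : ∀ h ∈ H, ∀ h' ∈ H, h'.1 = h.1 + 1 → h'.2 = h.2 → N h' = N h
  up : ∀ h ∈ H, ∀ h' ∈ H, h'.2 = h.2 + 1 → h'.1 = h.1 →
    N h' = N h + ((if a.1 < h.1 ∧ a.2 = h.2 + 1 then 1 else 0) +
      (if b.1 < h.1 ∧ b.2 = h.2 + 1 then 1 else 0))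
  eq_zero : ∀ h ∈ H, h.1 ≤ xl → N h = 0
  eq_ends : ∀ h ∈ H, h.1 = xr →
    N h = (if a.2 ≤ h.2 then 1 else 0) + (if b.2 ≤ h.2 then 1 else 0)

variable {A H : Set (ℤ × ℤ)} {xl xr : ℤ} {a b c d v w : ℤ × ℤ} {N : ℤ × ℤ → ZMod 2}

lemma IsCrossingNumber.zero : IsCrossingNumber H xl xr a a fun _ => 0 where
  right _ _ _ _ _ _ := rfl
  up _ _ _ _ _ _ := by rw [CharTwo.add_self_eq_zero, add_zero]
  eq_zero _ _ _ := rfl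
  eq_ends _ _ _ := (CharTwo.add_self_eq_zero _).symm

lemma IsCrossingNumber.add_crossing (hN : IsCrossingNumber H xl xr a v N) (hvw : PlanarStep v w)
    (hv : v ∉ H) (hw : w ∉ H) (hv' : xl ≤ v.1) (hw' : w.1 ≤ xr) :
    IsCrossingNumber H xl xr a w fun h => N h + crossing h v w where
  right h hh h' hh' h₁ h₂ := by
    rw [hN.right h hh h' hh' h₁ h₂, crossing_eq_of_right hvw h₁ h₂ (ne_of_mem_of_not_mem hh hv).symm
      (ne_of_mem_of_not_mem hh hw).symm]
  up h hh h' hh' h₂ h₁ := by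
    rw [hN.up h hh h' hh' h₂ h₁, crossing_eq_of_up hvw h₂ h₁ (ne_of_mem_of_not_mem hh' hv).symm
      (ne_of_mem_of_not_mem hh' hw).symm]
    linear_combination
      CharTwo.add_self_eq_zero (if v.1 < h.1 ∧ v.2 = h.2 + 1 then (1 : ZMod 2) else 0)
  eq_zero h hh hle := by rw [hN.eq_zero h hh hle, crossing, if_neg (by omega), add_zero]
  eq_ends h hh hxr := by
    rw [hN.eq_ends h hh hxr, crossing_of_le hvw (by omega) (ne_of_mem_of_not_mem hh hv).symm
      (ne_of_mem_of_not_mem hh hw).symm]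
    linear_combination CharTwo.add_self_eq_zero (if v.2 ≤ h.2 then (1 : ZMod 2) else 0)

lemma exists_isCrossingNumber (hAH : Disjoint A H) (hA : ∀ v ∈ A, xl ≤ v.1 ∧ v.1 ≤ xr)
    (hab : ReachIn PlanarStep A a b) : ∃ N, IsCrossingNumber H xl xr a b N :=
  hab.propagates (p := fun b => ∃ N, IsCrossingNumber H xl xr a b N) ⟨_, .zero⟩
    fun v hv w hw hvw ⟨_, hN⟩ => ⟨_, hN.add_crossing hvw (hAH.notMem_of_mem_left hv)
      (hAH.notMem_of_mem_left hw) (hA v hv).1 (hA w hw).2⟩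

/-- Only the endpoints of the first path could change the parity along the second one, and they lie
on the right-hand line. -/
lemma IsCrossingNumber.eq_zero_of_reachIn (hN : IsCrossingNumber H xl xr a b N) (ha : a.1 = xr)
    (hb : b.1 = xr) (hH : ∀ v ∈ H, v.1 ≤ xr) (hc : c.1 ≤ xl) (hcd : ReachIn PlanarStep H c d) :
    N d = 0 := by
  have up {h h'} (hh : h ∈ H) (hh' : h' ∈ H) (h₂ : h'.2 = h.2 + 1) (h₁ : h'.1 = h.1) :
      N h' = N h := by
    have := hH h hh
    rw [hN.up h hh h' hh' h₂ h₁, if_neg (by omega), if_neg (by omega), add_zero, add_zero]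
  refine hcd.propagates (p := (N · = 0)) (hN.eq_zero c hcd.left_mem hc) fun v hv w hw hvw hNv => ?_
  rcases planarStep_cases hvw with rfl | ⟨h₁, h₂⟩ | ⟨h₁, h₂⟩ | ⟨h₂, h₁⟩ | ⟨h₂, h₁⟩
  · exact hNv
  · rw [hN.right v hv w hw h₁ h₂, hNv]
  · rw [← hN.right w hw v hv h₁ h₂, hNv]
  · rw [up hv hw h₂ h₁, hNv]
  · rw [← up hw hv h₂ h₁, hNv]

/-- A discrete Jordan curve argument: the first path joins two points of the line `x = xr` inside
the strip `xl ≤ x ≤ xr`, and the second one comes from the left of the strip to a point between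
them. -/
theorem planar_paths_meet (hA : ∀ v ∈ A, xl ≤ v.1 ∧ v.1 ≤ xr) (hH : ∀ v ∈ H, v.1 ≤ xr)
    (hab : ReachIn PlanarStep A a b) (hcd : ReachIn PlanarStep H c d)
    (ha : a.1 = xr) (hb : b.1 = xr) (hd : d.1 = xr) (hc : c.1 ≤ xl)
    (had : a.2 ≤ d.2) (hdb : d.2 ≤ b.2) : ¬ Disjoint A H := by
  intro hAH
  obtain ⟨N, hN⟩ := exists_isCrossingNumber hAH hA hab
  have hbd : ¬ b.2 ≤ d.2 := fun hle =>
    hAH.ne_of_mem hab.right_mem hcd.right_mem (Prod.ext (hb.trans hd.symm) (le_antisymm hle hdb))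
  have parity := hN.eq_ends d hcd.right_mem hd
  rw [hN.eq_zero_of_reachIn ha hb hH hc hcd, if_pos had, if_neg hbd, add_zero] at parity
  exact zero_ne_one parity

end PlanarPaths

section ChainCounting

variable {J : Type*} (nb : J → Finset J)

section

variable [DecidableEq J]

/-- The lists of `L + 1` indices that start at a given index and follow `nb`. -/
def chainsFrom : ℕ → J → Finset (List J)
  | 0, i => {[i]}
  | L + 1, i => (nb i).biUnion fun j => (chainsFrom L j).image (i :: ·)

lemma card_chainsFrom_le {Δ : ℕ} (hΔ : ∀ i, (nb i).card ≤ Δ) (L : ℕ) (i : J) :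
    (chainsFrom nb L i).card ≤ Δ ^ L := by
  induction L generalizing i with
  | zero => exact Finset.card_le_one_iff_subset_singleton.2 ⟨[i], subset_rfl⟩
  | succ L ih =>
    rw [chainsFrom, pow_succ']
    exact (Finset.card_biUnion_le_card_mul _ _ _ fun j _ =>
      Finset.card_image_le.trans (ih j)).trans (Nat.mul_le_mul_right _ (hΔ i))

variable {nb}

lemma mem_chainsFrom {i : J} {l : List J} (h : (i :: l).IsChain fun a b => b ∈ nb a) :
    i :: l ∈ chainsFrom nb l.length i := by
  induction l generalizing i with
  | nil => exact Finset.mem_singleton_self _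
  | cons j l ih =>
    rw [List.isChain_cons_cons] at h
    exact Finset.mem_biUnion.2 ⟨j, h.1, Finset.mem_image_of_mem _ (ih h.2)⟩

end

variable {nb}

lemma iidMeasure_real_exists_chain_le {α : Type*} [MeasurableSpace α] [MeasurableSingletonClass α]
    (μ : Measure α) [IsProbabilityMeasure μ] (b : α) {Δ : ℕ} (hΔ : ∀ i, (nb i).card ≤ Δ)
    (W : Finset J) (L : ℕ) :
    (iidMeasure J μ).real {ω | ∃ i ∈ W, ∃ l : List J, l.length = L ∧
      ((i :: l).IsChain fun a b => b ∈ nb a) ∧ (i :: l).Nodup ∧ ∀ j ∈ i :: l, ω j = b} ≤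
      W.card * Δ ^ L * μ.real {b} ^ (L + 1) := by
  classical
  set C := W.biUnion fun i => {l ∈ chainsFrom nb L i | l.Nodup ∧ l.length = L + 1} with hC
  have card_C_le : C.card ≤ W.card * Δ ^ L := Finset.card_biUnion_le_card_mul _ _ _ fun i _ =>
    (Finset.card_filter_le _ _).trans (card_chainsFrom_le nb hΔ L i)
  calc _ ≤ (iidMeasure J μ).real (⋃ l ∈ C, {ω | ∀ j ∈ l.toFinset, ω j = b}) := by
        refine measureReal_mono ?_ (measure_ne_top _ _)
        rintro ω ⟨i, hi, l, rfl, hchain, hnodup, hω⟩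
        have mem_C : i :: l ∈ C := Finset.mem_biUnion.2
          ⟨i, hi, Finset.mem_filter.2 ⟨mem_chainsFrom hchain, hnodup, List.length_cons⟩⟩
        exact Set.mem_biUnion mem_C fun j hj => hω j (List.mem_toFinset.1 hj)
    _ ≤ ∑ l ∈ C, (iidMeasure J μ).real {ω | ∀ j ∈ l.toFinset, ω j = b} :=
        measureReal_biUnion_finset_le _ _
    _ = ∑ _l ∈ C, μ.real {b} ^ (L + 1) := by
        refine Finset.sum_congr rfl fun l hl => ?_
        obtain ⟨i, -, hl⟩ := Finset.mem_biUnion.1 hl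
        obtain ⟨-, hnodup, hlength⟩ := Finset.mem_filter.1 hl
        rw [iidMeasure_real_forall_mem_eq, List.toFinset_card_of_nodup hnodup, hlength]
    _ = C.card * μ.real {b} ^ (L + 1) := by rw [Finset.sum_const, nsmul_eq_mul]
    _ ≤ _ := by
        gcongr
        exact_mod_cast card_C_le

lemma abs_sub_le_of_isChain {r : J → J → Prop} {pos : J → ℤ} {d : ℤ}
    (hr : ∀ i j, r i j → |pos i - pos j| ≤ d) {a c : J} {l : List J} (hl : (a :: l).IsChain r)
    (hc : (a :: l).getLast? = some c) : |pos a - pos c| ≤ d * l.length := by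
  induction l generalizing a with
  | nil => simp_all
  | cons b l ih =>
    rw [List.isChain_cons_cons] at hl
    rw [List.getLast?_cons_cons] at hc
    have first_step := hr a b hl.1
    have other_steps := ih hl.2 hc
    have := abs_sub_le (pos a) (pos b) (pos c)
    push_cast [List.length_cons]
    linarith

lemma ReachIn.exists_isChain_of_length {r : J → J → Prop} {A : Set J} {pos : J → ℤ} {d : ℤ}
    (hd : 0 < d) (hr : ∀ i j, r i j → |pos i - pos j| ≤ d) {a c : J} (h : ReachIn r A a c) {L : ℕ}
    (hL : d * L ≤ |pos a - pos c|) :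
    ∃ l : List J, l.length = L ∧ (a :: l).IsChain r ∧ (a :: l).Nodup ∧ ∀ j ∈ a :: l, j ∈ A := by
  obtain ⟨l, hchain, hnodup, hlast⟩ := exists_nodup_isChain h.2
  have hLl : L ≤ l.length := by
    exact_mod_cast le_of_mul_le_mul_left
      (hL.trans (abs_sub_le_of_isChain (fun i j hij => hr i j hij.1) hchain hlast)) hd
  have init_prefix : a :: l.take L <+: a :: l :=
    List.cons_prefix_cons.2 ⟨rfl, List.take_prefix _ _⟩
  have forall_mem : ∀ j ∈ a :: l, j ∈ A :=
    hchain.induction (· ∈ A) _ (fun _ _ hstep _ => hstep.2.2) fun _ => h.left_mem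
  exact ⟨l.take L, List.length_take_of_le hLl, (hchain.prefix init_prefix).imp fun _ _ h => h.1,
    hnodup.sublist init_prefix.sublist, fun j hj => forall_mem j (init_prefix.subset hj)⟩

end ChainCounting

section SlabEdges

variable {k : ℕ}

/-- Edges of the slab whose planar projections are at `ℓ^∞`-distance at most two. This is generous
enough that two edges of the slab having a common endpoint, or belonging to a common square, are
near each other. -/
def Near (e f : (slab k).edgeSet) : Prop :=
  ∀ v ∈ e.1, ∀ w ∈ f.1, |v.1.1 - w.1.1| ≤ 2 ∧ |v.1.2 - w.1.2| ≤ 2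

open Classical in
/-- The edges with both endpoints in a finite set. -/
noncomputable def edgesIn (A : Finset (Vertex k)) : Finset (slab k).edgeSet :=
  A.sym2.subtype (· ∈ (slab k).edgeSet)

lemma mem_edgesIn {A : Finset (Vertex k)} {e : (slab k).edgeSet} :
    e ∈ edgesIn A ↔ ∀ v ∈ e.1, v ∈ A := by
  classical rw [edgesIn, Finset.mem_subtype, Finset.mem_sym2_iff]

lemma card_edgesIn_le (A : Finset (Vertex k)) : (edgesIn A).card ≤ A.card ^ 2 := by
  classical
  calc (edgesIn A).card ≤ A.sym2.card := by
        rw [edgesIn, Finset.card_subtype]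
        exact Finset.card_filter_le _ _
    _ = (A.card + 1) * A.card / 2 := by
        rw [Finset.card_sym2, Nat.choose_two_right, Nat.add_sub_cancel]
    _ ≤ A.card ^ 2 := Nat.div_le_of_le_mul (by nlinarith)

/-- The part of the slab over the rectangle `[a, b] × [c, d]`. -/
noncomputable def window (k : ℕ) (a b c d : ℤ) : Finset (Vertex k) :=
  (Finset.Icc a b ×ˢ Finset.Icc c d) ×ˢ Finset.univ

lemma mem_window {a b c d : ℤ} {v : Vertex k} :
    v ∈ window k a b c d ↔ (a ≤ v.1.1 ∧ v.1.1 ≤ b) ∧ c ≤ v.1.2 ∧ v.1.2 ≤ d := by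
  simp [window]

lemma card_window (a b c d : ℤ) :
    (window k a b c d).card = (b + 1 - a).toNat * (d + 1 - c).toNat * (k + 1) := by
  simp [window]

/-- One of the two endpoints of an edge, chosen arbitrarily. -/
noncomputable def endpoint (e : (slab k).edgeSet) : Vertex k := (Quot.out e.1).1

lemma endpoint_mem (e : (slab k).edgeSet) : endpoint e ∈ e.1 := Sym2.out_fst_mem e.1

/-- A finite set of edges that contains all edges near a given one. -/
noncomputable def nearEdges (e : (slab k).edgeSet) : Finset (slab k).edgeSet :=
  edgesIn (window k ((endpoint e).1.1 - 2) ((endpoint e).1.1 + 2)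
    ((endpoint e).1.2 - 2) ((endpoint e).1.2 + 2))

lemma Near.mem_nearEdges {e f : (slab k).edgeSet} (h : Near e f) : f ∈ nearEdges e := by
  rw [nearEdges, mem_edgesIn]
  intro v hv
  have := h _ (endpoint_mem e) v hv
  rw [abs_le, abs_le] at this
  rw [mem_window]
  omega

lemma card_nearEdges_le (e : (slab k).edgeSet) : (nearEdges e).card ≤ (25 * (k + 1)) ^ 2 := by
  have side (x : ℤ) : (x + 2 + 1 - (x - 2)).toNat = 5 := by omega
  refine (card_edgesIn_le _).trans_eq ?_
  rw [card_window, side, side]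

lemma abs_sub_le_one_of_adj {v w : Vertex k} (h : (slab k).Adj v w) :
    |v.1.1 - w.1.1| ≤ 1 ∧ |v.1.2 - w.1.2| ≤ 1 := by
  have h : |v.1.1 - w.1.1| + |v.1.2 - w.1.2| + |((v.2 : ℕ) : ℤ) - ((w.2 : ℕ) : ℤ)| = 1 := h
  have := abs_nonneg (v.1.1 - w.1.1)
  have := abs_nonneg (v.1.2 - w.1.2)
  have := abs_nonneg (((v.2 : ℕ) : ℤ) - ((w.2 : ℕ) : ℤ))
  omega

lemma abs_sub_le_one_of_mem {e : (slab k).edgeSet} {v w : Vertex k} (hv : v ∈ e.1)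
    (hw : w ∈ e.1) : |v.1.1 - w.1.1| ≤ 1 ∧ |v.1.2 - w.1.2| ≤ 1 := by
  by_cases hvw : v = w
  · simp [hvw]
  · apply abs_sub_le_one_of_adj
    rw [← SimpleGraph.mem_edgeSet, ← (Sym2.mem_and_mem_iff hvw).1 ⟨hv, hw⟩]
    exact e.2

lemma near_of_mem {e f : (slab k).edgeSet} {v : Vertex k} (he : v ∈ e.1) (hf : v ∈ f.1) :
    Near e f := by
  intro a ha b hb
  have h₁ := abs_sub_le_one_of_mem ha he
  have h₂ := abs_sub_le_one_of_mem hf hb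
  simp only [abs_le] at h₁ h₂ ⊢
  omega

/-- A finite set of edges that contains all edges of the two boxes having an endpoint on the line
`x = 3n`. -/
noncomputable def startEdges (k n : ℕ) : Finset (slab k).edgeSet :=
  edgesIn (window k (3 * n - 1) (3 * n + 1) (-(3 * n) - 1) (4 * n + 1))

lemma card_startEdges_le (k n : ℕ) :
    (startEdges k n).card ≤ 22500 * (k + 1) ^ 2 * (n / 3 - 1 + 1) ^ 2 := by
  have width : (3 * n + 1 + 1 - (3 * n - 1) : ℤ).toNat = 3 := by omega
  have height : (4 * n + 1 + 1 - (-(3 * n) - 1) : ℤ).toNat = 7 * n + 3 := by omega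
  calc (startEdges k n).card ≤ (3 * (7 * n + 3) * (k + 1)) ^ 2 := by
        rw [← height]
        nth_rw 1 [← width]
        rw [← card_window]
        exact card_edgesIn_le _
    _ ≤ (150 * (n / 3 - 1 + 1) * (k + 1)) ^ 2 := by
        gcongr ?_ ^ 2
        exact Nat.mul_le_mul_right _ (by omega)
    _ = 22500 * (k + 1) ^ 2 * (n / 3 - 1 + 1) ^ 2 := by ring

/-- Some chain of near edges in state `b` leads from the line `x = 3n` to the half-plane
`x ≤ x₀`. -/
def Linked (b : Bool) (n : ℕ) (x₀ : ℤ) (ω : Config k) : Prop :=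
  ∃ e₀ ∈ startEdges k n, ∃ e₁, (∃ v ∈ e₀.1, v.1.1 = 3 * n) ∧ (∃ v ∈ e₁.1, v.1.1 ≤ x₀) ∧
    ReachIn Near {e | ω e = b} e₀ e₁

lemma Linked.exists_isChain {b : Bool} {n : ℕ} {x₀ : ℤ} {ω : Config k} (h : Linked b n x₀ ω)
    (hx : 3 * x₀ ≤ 7 * n) :
    ∃ e ∈ startEdges k n, ∃ l : List (slab k).edgeSet, l.length = n / 3 - 1 ∧
      ((e :: l).IsChain fun f g => g ∈ nearEdges f) ∧ (e :: l).Nodup ∧ ∀ f ∈ e :: l, ω f = b := by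
  obtain ⟨e₀, he₀, e₁, ⟨v, hv, hv'⟩, ⟨w, hw, hw'⟩, hreach⟩ := h
  have near_v := (abs_sub_le_one_of_mem hv (endpoint_mem e₀)).1
  have near_w := (abs_sub_le_one_of_mem hw (endpoint_mem e₁)).1
  rw [abs_le] at near_v near_w
  have far_apart : 2 * ((n / 3 - 1 : ℕ) : ℤ) ≤ |(endpoint e₀).1.1 - (endpoint e₁).1.1| := by
    have := le_abs_self ((endpoint e₀).1.1 - (endpoint e₁).1.1)
    have := abs_nonneg ((endpoint e₀).1.1 - (endpoint e₁).1.1)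
    omega
  obtain ⟨l, hl, hchain, hnodup, hstate⟩ := hreach.exists_isChain_of_length
    (pos := fun e => (endpoint e).1.1) two_pos
    (fun e f hef => (hef _ (endpoint_mem e) _ (endpoint_mem f)).1) far_apart
  exact ⟨e₀, he₀, l, hl, hchain.imp fun _ _ h => h.mem_nearEdges, hnodup, hstate⟩

/-- The constant in the bound on the probability of long chains. -/
def chainConst (k : ℕ) : ℕ := 90000 * (k + 1) ^ 2 * (25 * (k + 1)) ^ 2

lemma chainConst_pos (k : ℕ) : 0 < chainConst k := by
  unfold chainConst
  positivity

lemma peierls_sum_le {c Δ q : ℝ} (hc : 0 ≤ c) (hΔ : 1 ≤ Δ) (hq : 0 ≤ q) (hq' : 4 * Δ * q ≤ 1)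
    (L : ℕ) : c * (L + 1) ^ 2 * Δ ^ L * q ^ (L + 1) ≤ c * (4 * Δ * q) := by
  have sq_le : ((L : ℝ) + 1) ^ 2 ≤ 4 ^ (L + 1) := by
    have : (L : ℝ) + 1 ≤ 2 ^ (L + 1) := by exact_mod_cast (Nat.lt_two_pow_self (n := L + 1)).le
    calc ((L : ℝ) + 1) ^ 2 ≤ (2 ^ (L + 1)) ^ 2 := by gcongr
      _ = 4 ^ (L + 1) := by rw [← pow_mul, mul_comm (L + 1), pow_mul]; norm_num
  calc c * (L + 1) ^ 2 * Δ ^ L * q ^ (L + 1) ≤ c * 4 ^ (L + 1) * Δ ^ (L + 1) * q ^ (L + 1) := by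
        gcongr
        exact Nat.le_succ L
    _ = c * (4 * Δ * q) ^ (L + 1) := by rw [mul_pow, mul_pow]; ring
    _ ≤ c * (4 * Δ * q) := by
        gcongr
        exact pow_le_of_le_one (by positivity) hq' (Nat.succ_ne_zero L)

/-- Peierls' argument. -/
theorem iidMeasure_real_linked_le (μ : Measure Bool) [IsProbabilityMeasure μ] (b : Bool) {n : ℕ}
    {x₀ : ℤ} (hx : 3 * x₀ ≤ 7 * n) :
    (iidMeasure (slab k).edgeSet μ).real {ω | Linked b n x₀ ω} ≤
      chainConst k * μ.real {b} := by
  set q := μ.real {b}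
  have chainConst_eq : (chainConst k * q : ℝ) =
      22500 * (k + 1) ^ 2 * (4 * (25 * (k + 1)) ^ 2 * q) := by
    push_cast [chainConst]
    ring
  have hk : (1 : ℝ) ≤ (k + 1) ^ 2 := one_le_pow₀ (by simp)
  rw [chainConst_eq]
  rcases le_or_gt 1 (4 * (25 * (k + 1)) ^ 2 * q) with large | small
  · exact measureReal_le_one.trans (one_le_mul_of_one_le_of_one_le (by linarith) large)
  · calc _ ≤ (startEdges k n).card * ((25 * (k + 1)) ^ 2 : ℕ) ^ (n / 3 - 1) *
            q ^ (n / 3 - 1 + 1) := by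
          refine (measureReal_mono fun ω h => ?_).trans
            (iidMeasure_real_exists_chain_le μ b card_nearEdges_le (startEdges k n) (n / 3 - 1))
          exact Linked.exists_isChain h hx
      _ ≤ 22500 * (k + 1) ^ 2 * ((n / 3 - 1 : ℕ) + 1) ^ 2 * ((25 * (k + 1)) ^ 2) ^ (n / 3 - 1) *
            q ^ (n / 3 - 1 + 1) := by
          gcongr
          · exact_mod_cast card_startEdges_le k n
          · push_cast; rfl
      _ ≤ _ := peierls_sum_le (by positivity) (by nlinarith) measureReal_nonneg small.le _

end SlabEdges

section Graphs

variable {V : Type*}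

instance (G : SimpleGraph V) : Std.Symm G.Adj := G.symm

lemma reachable_induce_iff {G : SimpleGraph V} {A : Set V} {x y : A} :
    (G.induce A).Reachable x y ↔ ReachIn G.Adj A x y := by
  rw [SimpleGraph.reachable_iff_reflTransGen]
  constructor
  · intro h
    induction h with
    | refl => exact .refl x.2
    | tail _ hvw ih => exact ih.tail hvw (Subtype.property _)
  · intro h
    obtain ⟨_, h⟩ := h.propagates
      (p := fun v => ∃ hv : v ∈ A, Relation.ReflTransGen (G.induce A).Adj x ⟨v, hv⟩)
      ⟨x.2, .refl⟩ fun v _ w hw hvw ⟨_, hxv⟩ => ⟨hw, hxv.tail hvw⟩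
    exact h

lemma reachIn_of_le {r : V → V → Prop} {A : Set V} (f : ℤ → V) {a b : ℤ} (hab : a ≤ b)
    (hA : ∀ i, a ≤ i → i ≤ b → f i ∈ A) (hr : ∀ i, r (f i) (f (i + 1))) :
    ReachIn r A (f a) (f b) := by
  induction b, hab using Int.leInduction with
  | base => exact .refl (hA a le_rfl le_rfl)
  | succ b hab ih =>
    exact (ih fun i h₁ h₂ => hA i h₁ (by omega)).tail (hr b) (hA _ (by omega) le_rfl)

lemma reachIn_line {r : V → V → Prop} [Std.Symm r] {A : Set V} (f : ℤ → V) (a b : ℤ)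
    (hA : ∀ i, min a b ≤ i → i ≤ max a b → f i ∈ A) (hr : ∀ i, r (f i) (f (i + 1))) :
    ReachIn r A (f a) (f b) := by
  rcases le_total a b with hab | hab
  · exact reachIn_of_le f hab (by simpa [hab] using hA) hr
  · exact (reachIn_of_le f hab (by simpa [hab] using hA) hr).symm

end Graphs

section Boxes

variable {k : ℕ}

@[simp] lemma mem_lift {E : Set (ℤ × ℤ)} {v : Vertex k} : v ∈ lift k E ↔ v.1 ∈ E := Iff.rfl

lemma mem_connected_iff {B X Y : Set (ℤ × ℤ)} {ω : Config k} :
    ω ∈ connected k B X Y ↔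
      ∃ x ∈ lift k X, ∃ y ∈ lift k Y, ReachIn (openGraph ω).Adj (lift k B) x y := by
  constructor
  · rintro ⟨C, ⟨x, hx, hxX⟩, y, hy, hyY⟩
    exact ⟨x, hxX, y, hyY, reachable_induce_iff.1 (C.reachable_of_mem_supp hx hy)⟩
  · rintro ⟨x, hx, y, hy, hxy⟩
    have hreach : ((openGraph ω).induce (lift k B)).Reachable ⟨x, hxy.left_mem⟩
        ⟨y, hxy.right_mem⟩ := reachable_induce_iff.2 hxy
    exact ⟨_, ⟨_, rfl, hx⟩, _, SimpleGraph.ConnectedComponent.eq.2 hreach.symm, hy⟩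

variable {u α y : ℕ → ℕ} {n : ℕ} {v : ℤ × ℤ}

lemma mem_box : v ∈ box n ↔ (-(n : ℤ) ≤ v.1 ∧ v.1 ≤ n) ∧ -(n : ℤ) ≤ v.2 ∧ v.2 ≤ n := by
  rw [box, Set.mem_prod, Set.mem_Icc, Set.mem_Icc]

lemma mem_B' : v ∈ B' y n ↔
    ((n : ℤ) ≤ v.1 ∧ v.1 ≤ 3 * n) ∧ (y (3 * n) : ℤ) - n ≤ v.2 ∧ v.2 ≤ y (3 * n) + n := by
  rw [B', Set.mem_vadd_set_iff_neg_vadd_mem, mem_box]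
  simp only [vadd_eq_add, Prod.fst_add, Prod.snd_add, Prod.fst_neg, Prod.snd_neg]
  omega

lemma mem_S' : v ∈ S' u y n ↔
    (2 * (n : ℤ) - u n ≤ v.1 ∧ v.1 ≤ 2 * n + u n) ∧
      (y (3 * n) : ℤ) - u n ≤ v.2 ∧ v.2 ≤ y (3 * n) + u n := by
  rw [S', Set.mem_vadd_set_iff_neg_vadd_mem, S, mem_box]
  simp only [vadd_eq_add, Prod.fst_add, Prod.snd_add, Prod.fst_neg, Prod.snd_neg]
  omega

lemma mem_Yplus : v ∈ Yplus α y n ↔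
    v.1 = 3 * n ∧ (y (3 * n) : ℤ) + α n ≤ v.2 ∧ v.2 ≤ y (3 * n) + n := by
  rw [Yplus, Set.mem_prod, Set.mem_singleton_iff, Set.mem_Icc]

lemma mem_Yminus : v ∈ Yminus α y n ↔
    v.1 = 3 * n ∧ (y (3 * n) : ℤ) - n ≤ v.2 ∧ v.2 ≤ y (3 * n) - α n := by
  rw [Yminus, Set.mem_prod, Set.mem_singleton_iff, Set.mem_Icc]

lemma mem_Z : v ∈ Z α y n ↔
    v.1 = 3 * n ∧ (y (3 * n) : ℤ) - α n ≤ v.2 ∧ v.2 ≤ y (3 * n) + α n := by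
  rw [Z, Set.mem_prod, Set.mem_singleton_iff, Set.mem_Icc]

/-- The union of the boxes `B₃ₙ` and `B'ₙ`. -/
def region (y : ℕ → ℕ) (n : ℕ) : Set (ℤ × ℤ) := box (3 * n) ∪ B' y n

lemma mem_region : v ∈ region y n ↔
    (-(3 * (n : ℤ)) ≤ v.1 ∧ v.1 ≤ 3 * n ∧ -(3 * (n : ℤ)) ≤ v.2 ∧ v.2 ≤ 3 * n) ∨
    ((n : ℤ) ≤ v.1 ∧ v.1 ≤ 3 * n ∧ (y (3 * n) : ℤ) - n ≤ v.2 ∧ v.2 ≤ y (3 * n) + n) := by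
  rw [region, Set.mem_union, mem_box, mem_B']
  push_cast
  simp only [and_assoc]

lemma mem_startEdges (hy : y (3 * n) ≤ 3 * n) {e : (slab k).edgeSet} {v : Vertex k}
    (hv : v ∈ e.1) (hx : v.1.1 = 3 * n) (hR : v.1 ∈ region y n) : e ∈ startEdges k n := by
  rw [startEdges, mem_edgesIn]
  intro w hw
  have h := abs_sub_le_one_of_mem hv hw
  rw [abs_le, abs_le] at h
  rw [mem_region] at hR
  rw [mem_window]
  omega

lemma linked_of_reachIn (hy : y (3 * n) ≤ 3 * n) {x₀ : ℤ} {ω : Config k} {a b : Vertex k}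
    (h : ReachIn (openGraph ω).Adj (lift k (region y n)) a b) (ha : a.1.1 ≤ x₀)
    (hx : x₀ < 3 * n) (hb : b.1.1 = 3 * n) : Linked true n x₀ ω := by
  have open_chain : a = b ∨ ∃ e₀ e₁ : (slab k).edgeSet, b ∈ e₀.1 ∧ a ∈ e₁.1 ∧
      ReachIn Near {e | ω e = true} e₀ e₁ := by
    refine h.symm.propagates (p := fun a => a = b ∨ ∃ e₀ e₁ : (slab k).edgeSet, b ∈ e₀.1 ∧
      a ∈ e₁.1 ∧ ReachIn Near {e | ω e = true} e₀ e₁) (.inl rfl) ?_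
    rintro v _ w _ ⟨he, ho⟩ (rfl | ⟨e₀, e₁, h₀, h₁, hreach⟩)
    · exact .inr ⟨⟨_, he⟩, ⟨_, he⟩, Sym2.mem_mk_left _ _, Sym2.mem_mk_right _ _, .refl ho⟩
    · exact .inr ⟨e₀, ⟨_, he⟩, h₀, Sym2.mem_mk_right _ _,
        hreach.tail (near_of_mem h₁ (Sym2.mem_mk_left _ _)) ho⟩
  rcases open_chain with rfl | ⟨e₀, e₁, h₀, h₁, hreach⟩
  · omega
  · exact ⟨e₀, mem_startEdges hy h₀ hb h.right_mem, e₁, ⟨b, h₀, hb⟩, ⟨a, h₁, ha⟩, hreach⟩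

end Boxes

section SlabSteps

variable {k : ℕ}

lemma slab_adj_right (a b : ℤ) (i : Fin (k + 1)) : (slab k).Adj ((a, b), i) ((a + 1, b), i) := by
  simp [slab]

lemma slab_adj_up (a b : ℤ) (i : Fin (k + 1)) : (slab k).Adj ((a, b), i) ((a, b + 1), i) := by
  simp [slab]

lemma reachIn_column (z : ℤ × ℤ) (i j : Fin (k + 1)) :
    ReachIn (slab k).Adj {v | v.1 = z} (z, i) (z, j) := by
  have from_bottom (i : Fin (k + 1)) : ReachIn (slab k).Adj {v | v.1 = z} (z, 0) (z, i) := by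
    induction i using Fin.induction with
    | zero => exact .refl rfl
    | succ i ih => exact ih.tail (by simp [slab]) rfl
  exact (from_bottom i).symm.trans (from_bottom j)

lemma slab_adj_cases {a b : Vertex k} (h : (slab k).Adj a b) :
    a.1.1 = b.1.1 ∨ b = ((a.1.1 + 1, a.1.2), a.2) ∨ a = ((b.1.1 + 1, b.1.2), b.2) := by
  have h : |a.1.1 - b.1.1| + |a.1.2 - b.1.2| + |((a.2 : ℕ) : ℤ) - ((b.2 : ℕ) : ℤ)| = 1 := h
  simp only [Prod.ext_iff, Fin.ext_iff]
  grind

lemma planarStep_of_adj {a b : Vertex k} (h : (slab k).Adj a b) : PlanarStep a.1 b.1 := by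
  have h : |a.1.1 - b.1.1| + |a.1.2 - b.1.2| + |((a.2 : ℕ) : ℤ) - ((b.2 : ℕ) : ℤ)| = 1 := h
  have := abs_nonneg (((a.2 : ℕ) : ℤ) - ((b.2 : ℕ) : ℤ))
  unfold PlanarStep
  omega

end SlabSteps

section Contours

variable {k : ℕ}

/-- The edges within `R` that leave `C`. -/
def boundaryEdges (R C : Set (Vertex k)) : Set (slab k).edgeSet :=
  {e | ∃ a ∈ R ∩ C, ∃ b ∈ R \ C, e.1 = s(a, b)}

/-- The indicator modulo two of a set of edges, as a function of the two endpoints. -/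
noncomputable def edgeInd (W : Set (slab k).edgeSet) (a b : Vertex k) : ZMod 2 :=
  (Subtype.val '' W).indicator 1 s(a, b)

/-- The number modulo two of edges of `W` on the horizontal line that leads from the plane
`x = x₀` to `v`. -/
noncomputable def potential (W : Set (slab k).edgeSet) (x₀ : ℤ) (v : Vertex k) : ZMod 2 :=
  ∑ j ∈ Finset.range (v.1.1 - x₀).toNat,
    edgeInd W ((x₀ + j, v.1.2), v.2) ((x₀ + j + 1, v.1.2), v.2)

/-- `W` consists of the edges leaving `C` to the right of the plane `x = x₀`, and is a union of
classes of the relation generated by `Near` on `boundaryEdges R C`. -/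
structure IsContour (R C : Set (Vertex k)) (x₀ : ℤ) (W : Set (slab k).edgeSet) : Prop where
  subset : W ⊆ boundaryEdges R C
  mem_of_near : ∀ e ∈ W, ∀ f ∈ boundaryEdges R C, Near e f → f ∈ W
  lt_of_mem : ∀ e ∈ W, ∀ v ∈ e.1, x₀ < v.1.1

variable {R C : Set (Vertex k)} {W : Set (slab k).edgeSet} {x₀ : ℤ} {a b : Vertex k}

lemma edgeInd_comm (a b : Vertex k) : edgeInd W a b = edgeInd W b a := by
  rw [edgeInd, edgeInd, Sym2.eq_swap]

lemma edgeInd_of_mem {e : (slab k).edgeSet} (he : e ∈ W) (hab : e.1 = s(a, b)) :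
    edgeInd W a b = 1 := by
  rw [edgeInd, ← hab, Set.indicator_of_mem (Set.mem_image_of_mem _ he), Pi.one_apply]

lemma edgeInd_of_forall_notMem (h : ∀ e ∈ W, e.1 ≠ s(a, b)) : edgeInd W a b = 0 :=
  Set.indicator_of_notMem (by rintro ⟨e, he, hab⟩; exact h e he hab) _

lemma edgeInd_congr {W' : Set (slab k).edgeSet}
    (h : ∀ e : (slab k).edgeSet, e.1 = s(a, b) → (e ∈ W ↔ e ∈ W')) :
    edgeInd W a b = edgeInd W' a b := by
  by_cases hab : ∃ e ∈ W, e.1 = s(a, b)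
  · obtain ⟨e, he, hab⟩ := hab
    rw [edgeInd_of_mem he hab, edgeInd_of_mem ((h e hab).1 he) hab]
  · push Not at hab
    rw [edgeInd_of_forall_notMem hab,
      edgeInd_of_forall_notMem fun e he he' => hab e ((h e he').2 he) he']

lemma indicator_add_indicator (h : (slab k).Adj a b) (ha : a ∈ R) (hb : b ∈ R) :
    C.indicator 1 a + C.indicator 1 b = edgeInd (boundaryEdges R C) a b := by
  by_cases ha' : a ∈ C <;> by_cases hb' : b ∈ C
  · rw [edgeInd_of_forall_notMem]
    · simpa [ha', hb'] using CharTwo.add_self_eq_zero _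
    · rintro e ⟨a', -, b', hb'', he⟩ he'
      rcases Sym2.eq_iff.1 (he.symm.trans he') with ⟨rfl, rfl⟩ | ⟨rfl, rfl⟩
      · exact hb''.2 hb'
      · exact hb''.2 ha'
  · rw [edgeInd_of_mem (e := ⟨s(a, b), h⟩) (.intro a ⟨⟨ha, ha'⟩, b, ⟨hb, hb'⟩, rfl⟩) rfl]
    simp [ha', hb']
  · rw [edgeInd_of_mem (e := ⟨s(a, b), h⟩) (.intro b ⟨⟨hb, hb'⟩, a, ⟨ha, ha'⟩, Sym2.eq_swap⟩) rfl]
    simp [ha', hb']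
  · rw [edgeInd_of_forall_notMem]
    · simp [ha', hb']
    · rintro e ⟨a', ha'', b', -, he⟩ he'
      rcases Sym2.eq_iff.1 (he.symm.trans he') with ⟨rfl, rfl⟩ | ⟨rfl, rfl⟩
      · exact ha' ha''.2
      · exact hb' ha''.2

lemma potential_of_le {v : Vertex k} (h : v.1.1 ≤ x₀) : potential W x₀ v = 0 := by
  rw [potential, Int.toNat_of_nonpos (by omega), Finset.range_zero, Finset.sum_empty]

lemma potential_right {x : ℤ} (h : x₀ ≤ x) (y : ℤ) (i : Fin (k + 1)) :
    potential W x₀ ((x + 1, y), i) =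
      potential W x₀ ((x, y), i) + edgeInd W ((x, y), i) ((x + 1, y), i) := by
  have one_more : (x + 1 - x₀).toNat = (x - x₀).toNat + 1 := by omega
  have last_edge : x₀ + ((x - x₀).toNat : ℤ) = x := by omega
  rw [potential, potential, one_more, Finset.sum_range_succ, last_edge]

namespace IsContour

variable (hW : IsContour R C x₀ W)
include hW

lemma edgeInd_of_le (ha : a.1.1 ≤ x₀) : edgeInd W a b = 0 :=
  edgeInd_of_forall_notMem fun e he hab =>
    ha.not_gt (hW.lt_of_mem e he a (hab ▸ Sym2.mem_mk_left a b))

/-- Locally, either `W` is empty or it is the whole boundary of `C`. -/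
lemma exists_eq_add (c : ℤ × ℤ) : ∃ g : Vertex k → ZMod 2,
    ∀ a ∈ R, ∀ b ∈ R, (slab k).Adj a b → a ∈ window k (c.1 - 1) (c.1 + 1) (c.2 - 1) (c.2 + 1) →
      b ∈ window k (c.1 - 1) (c.1 + 1) (c.2 - 1) (c.2 + 1) → edgeInd W a b = g a + g b := by
  set Q := window k (c.1 - 1) (c.1 + 1) (c.2 - 1) (c.2 + 1)
  by_cases hQ : ∃ e ∈ W, ∀ v ∈ e.1, v ∈ Q
  · obtain ⟨e, he, heQ⟩ := hQ
    refine ⟨C.indicator 1, fun a haR b hbR hab ha hb => ?_⟩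
    rw [indicator_add_indicator hab haR hbR]
    refine edgeInd_congr fun f hf => ⟨fun hfW => hW.subset hfW, fun hfC => ?_⟩
    refine hW.mem_of_near e he f hfC fun v hv w hw => ?_
    have hvQ := mem_window.1 (heQ v hv)
    have hwQ : w ∈ Q := by
      rw [hf, Sym2.mem_iff] at hw
      rcases hw with rfl | rfl <;> assumption
    rw [mem_window] at hwQ
    rw [abs_le, abs_le]
    omega
  · refine ⟨0, fun a _ b _ _ ha hb => edgeInd_of_forall_notMem fun e he hab => hQ ⟨e, he, ?_⟩⟩
    rw [hab]
    rintro v hv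
    rcases Sym2.mem_iff.1 hv with rfl | rfl <;> assumption

variable (hR : ∀ x y i, x₀ ≤ x → ((x + 1, y), i) ∈ R → ((x, y), i) ∈ R)
include hR

lemma potential_add_of_eq (h : (slab k).Adj a b) (hx : a.1.1 = b.1.1) (ha : a ∈ R) (hb : b ∈ R) :
    potential W x₀ a + potential W x₀ b = edgeInd W a b := by
  obtain ⟨⟨x, y⟩, i⟩ := a
  obtain ⟨⟨x', y'⟩, j⟩ := b
  obtain rfl : x = x' := hx
  have hadj (x : ℤ) : (slab k).Adj ((x, y), i) ((x, y'), j) := by simpa [slab] using h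
  have of_le (x : ℤ) (hx : x ≤ x₀) : potential W x₀ ((x, y), i) + potential W x₀ ((x, y'), j) =
      edgeInd W ((x, y), i) ((x, y'), j) := by
    rw [potential_of_le (by exact hx), potential_of_le (by exact hx),
      hW.edgeInd_of_le (by exact hx), add_zero]
  rcases le_total x x₀ with hx | hx
  · exact of_le x hx
  clear h
  induction x, hx using Int.leInduction with
  | base => exact of_le x₀ le_rfl
  | succ x hx ih =>
    have ha' := hR x y i hx ha
    have hb' := hR x y' j hx hb
    obtain ⟨g, hg⟩ := hW.exists_eq_add (x, y)
    have hy := abs_le.1 (abs_sub_le_one_of_adj (hadj x)).2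
    dsimp only at hy
    have lower (s : ℤ) (hs : s = x ∨ s = x + 1) :
        ((s, y), i) ∈ window k (x - 1) (x + 1) (y - 1) (y + 1) := by
      rw [mem_window]
      dsimp only
      omega
    have upper (s : ℤ) (hs : s = x ∨ s = x + 1) :
        ((s, y'), j) ∈ window k (x - 1) (x + 1) (y - 1) (y + 1) := by
      rw [mem_window]
      dsimp only
      omega
    have bottom := hg _ ha' _ ha (slab_adj_right x y i) (lower x (.inl rfl)) (lower _ (.inr rfl))
    have top := hg _ hb' _ hb (slab_adj_right x y' j) (upper x (.inl rfl)) (upper _ (.inr rfl))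
    have left := hg _ ha' _ hb' (hadj x) (lower x (.inl rfl)) (upper x (.inl rfl))
    have right := hg _ ha _ hb (hadj (x + 1)) (lower _ (.inr rfl)) (upper _ (.inr rfl))
    rw [potential_right hx, potential_right hx]
    grind

/-- The number of edges of `W` on a horizontal line is a discrete potential: the contribution of
the squares that the line sweeps when it moves vanishes, since a contour crosses every square an
even number of times. -/
lemma potential_add (h : (slab k).Adj a b) (ha : a ∈ R) (hb : b ∈ R) :
    potential W x₀ a + potential W x₀ b = edgeInd W a b := by
  have add_right (a : Vertex k) :
      potential W x₀ a + potential W x₀ ((a.1.1 + 1, a.1.2), a.2) =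
        edgeInd W a ((a.1.1 + 1, a.1.2), a.2) := by
    rcases lt_or_ge a.1.1 x₀ with hlt | hge
    · rw [potential_of_le hlt.le, potential_of_le (by exact hlt), hW.edgeInd_of_le hlt.le,
        add_zero]
    · rw [potential_right hge, ← add_assoc, CharTwo.add_self_eq_zero, zero_add]
  rcases slab_adj_cases h with he | rfl | rfl
  · exact hW.potential_add_of_eq hR h he ha hb
  · exact add_right a
  · rw [add_comm, edgeInd_comm, add_right b]

lemma potential_eq_of_reachIn {r : Vertex k → Vertex k → Prop}
    (hr : ∀ a ∈ R, ∀ b ∈ R, r a b → (slab k).Adj a b ∧ ∀ e ∈ W, e.1 ≠ s(a, b))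
    (h : ReachIn r R a b) : potential W x₀ b = potential W x₀ a := by
  refine h.propagates (p := fun v => potential W x₀ v = potential W x₀ a) rfl ?_
  intro v hv w hw hvw ih
  obtain ⟨hadj, notMem⟩ := hr v hv w hw hvw
  rw [← ih, eq_comm, ← CharTwo.add_eq_zero, hW.potential_add hR hadj hv hw,
    edgeInd_of_forall_notMem notMem]

/-- If `W` contains every edge of the boundary of `C` in a set `T`, then the potential and the
indicator of `C` jump at the same edges of `T`. -/
lemma mem_iff_of_reachIn {T : Set (Vertex k)}
    (hT : ∀ e ∈ boundaryEdges R C, (∀ v ∈ e.1, v ∈ T) → e ∈ W)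
    (h : ReachIn (slab k).Adj (R ∩ T) a b) (hab : potential W x₀ a = potential W x₀ b) :
    a ∈ C ↔ b ∈ C := by
  have jump : potential W x₀ b + C.indicator 1 b = potential W x₀ a + C.indicator 1 a := by
    refine h.propagates (p := fun v =>
      potential W x₀ v + C.indicator 1 v = potential W x₀ a + C.indicator 1 a) rfl ?_
    rintro v ⟨hv, hvT⟩ w ⟨hw, hwT⟩ hvw ih
    have same_edges : edgeInd W v w = edgeInd (boundaryEdges R C) v w := by
      refine edgeInd_congr fun e he => ⟨fun heW => hW.subset heW, fun heC => hT e heC ?_⟩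
      rw [he]
      rintro u hu
      rcases Sym2.mem_iff.1 hu with rfl | rfl <;> assumption
    have := hW.potential_add hR hvw hv hw
    have := indicator_add_indicator (C := C) hvw hv hw
    grind
  rw [hab, add_right_inj] at jump
  by_cases ha : a ∈ C <;> by_cases hb : b ∈ C <;> simp_all

end IsContour

end Contours

section Separation

variable {k : ℕ} {y : ℕ → ℕ} {n : ℕ}

lemma region_left_mem {x₀ : ℤ} (hn : (n : ℤ) ≤ x₀) (a b : ℤ) (i : Fin (k + 1)) (ha : x₀ ≤ a)
    (h : ((a + 1, b), i) ∈ lift k (region y n)) : ((a, b), i) ∈ lift k (region y n) := by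
  rw [mem_lift, mem_region] at h ⊢
  dsimp only at h ⊢
  omega

lemma reachIn_right_side (hy : y (3 * n) ≤ 3 * n) {a b : Vertex k}
    (ha : a ∈ lift k (region y n))
    (hb : b ∈ lift k (region y n)) (ha₁ : a.1.1 = 3 * n) (hb₁ : b.1.1 = 3 * n) :
    ReachIn (slab k).Adj (lift k (region y n) ∩ {v | v.1.1 = 3 * n}) a b := by
  obtain ⟨⟨a₁, a₂⟩, i⟩ := a
  obtain ⟨⟨b₁, b₂⟩, j⟩ := b
  obtain rfl : a₁ = 3 * n := ha₁
  obtain rfl : b₁ = 3 * n := hb₁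
  have along_line := reachIn_line (A := lift k (region y n) ∩ {v | v.1.1 = 3 * n})
    (fun c => ((3 * (n : ℤ), c), i)) a₂ b₂ (fun c hc hc' => ⟨?_, rfl⟩)
    fun c => slab_adj_up (3 * (n : ℤ)) c i
  · refine along_line.trans ((reachIn_column _ i j).mono (fun _ _ _ _ h => h) ?_)
    rintro ⟨v, j⟩ rfl
    exact ⟨hb, rfl⟩
  · rw [mem_lift, mem_region] at ha hb ⊢
    dsimp only at ha hb ⊢
    omega

/-- The edges of the boundary of `C` within `R` that are joined, by a chain of near edges of this
boundary, to the line `x = 3n`. -/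
def attachedBoundary (n : ℕ) (R C : Set (Vertex k)) : Set (slab k).edgeSet :=
  {e | ∃ e₀ ∈ startEdges k n, (∃ v ∈ e₀.1, v.1.1 = 3 * n) ∧ ReachIn Near (boundaryEdges R C) e₀ e}

lemma isContour_attachedBoundary {R C : Set (Vertex k)} {x₀ : ℤ} {ω : Config k}
    (closed : boundaryEdges R C ⊆ {e | ω e = false}) (not_linked : ¬ Linked false n x₀ ω) :
    IsContour R C x₀ (attachedBoundary n R C) := by
  refine ⟨?_, ?_, ?_⟩
  · rintro e ⟨e₀, -, -, h⟩
    exact h.right_mem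
  · rintro e ⟨e₀, h₀, h₁, h⟩ f hf hef
    exact ⟨e₀, h₀, h₁, h.tail hef hf⟩
  · rintro e ⟨e₀, h₀, h₁, h⟩ v hv
    by_contra hle
    exact not_linked
      ⟨e₀, h₀, e, h₁, ⟨v, hv, not_lt.1 hle⟩, h.mono (fun _ _ _ _ h => h) closed⟩

lemma mem_attachedBoundary_of_right_side (hy : y (3 * n) ≤ 3 * n) {C : Set (Vertex k)}
    {e : (slab k).edgeSet} (he : e ∈ boundaryEdges (lift k (region y n)) C)
    (hv : ∀ v ∈ e.1, v.1.1 = 3 * n) : e ∈ attachedBoundary n (lift k (region y n)) C := by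
  obtain ⟨a, ha, b, -, hab⟩ := id he
  have hae : a ∈ e.1 := hab ▸ Sym2.mem_mk_left a b
  exact ⟨e, mem_startEdges hy hae (hv a hae) ha.1, ⟨a, hae, hv a hae⟩, .refl he⟩

/-- Let `C` be the cluster of `s`. Were there no closed chain, the contour of `C` attached to the
line `x = 3n` would stay to the right of the plane `x = x₀`. Its potential would then vanish at
both `z` and `t'`, so that the line would cross the boundary of `C` an even number of times between
them. But only one of them belongs to `C`. -/
theorem linked_of_separated (hy : y (3 * n) ≤ 3 * n) {x₀ : ℤ} (hn : (n : ℤ) ≤ x₀) {ω : Config k}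
    {s z s' t' : Vertex k} (hsz : ReachIn (openGraph ω).Adj (lift k (region y n)) s z)
    (hst : ReachIn (openGraph ω).Adj (lift k (region y n)) s' t')
    (hsep : ¬ ReachIn (openGraph ω).Adj (lift k (region y n)) s s')
    (hs : s.1.1 ≤ x₀) (hs' : s'.1.1 ≤ x₀) (hz : z.1.1 = 3 * n) (ht : t'.1.1 = 3 * n) :
    Linked false n x₀ ω := by
  by_contra not_linked
  set R := lift k (region y n)
  set C : Set (Vertex k) := {v | ReachIn (openGraph ω).Adj R s v}
  set W := attachedBoundary n R C
  have closed : boundaryEdges R C ⊆ {e | ω e = false} := by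
    rintro ⟨_, he⟩ ⟨a, ha, b, hb, rfl⟩
    by_contra hopen
    exact hb.2 (ReachIn.tail ha.2 ⟨he, by simpa using hopen⟩ hb.1)
  have hW : IsContour R C x₀ W := isContour_attachedBoundary closed not_linked
  have hR := region_left_mem (k := k) (y := y) hn
  have open_step (a : Vertex k) (_ : a ∈ R) (b : Vertex k) (_ : b ∈ R) :
      (openGraph ω).Adj a b → (slab k).Adj a b ∧ ∀ e ∈ W, e.1 ≠ s(a, b) := by
    rintro ⟨hadj, hopen⟩
    refine ⟨hadj, fun e he hab => ?_⟩
    obtain rfl : e = ⟨s(a, b), hadj⟩ := Subtype.ext hab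
    exact Bool.false_ne_true ((closed (hW.subset he)).symm.trans hopen)
  have potential_z : potential W x₀ z = 0 :=
    (hW.potential_eq_of_reachIn hR open_step hsz).trans (potential_of_le hs)
  have potential_t' : potential W x₀ t' = 0 :=
    (hW.potential_eq_of_reachIn hR open_step hst).trans (potential_of_le hs')
  have t'_mem : t' ∈ C := (hW.mem_iff_of_reachIn hR
    (fun e he => mem_attachedBoundary_of_right_side hy he)
    (reachIn_right_side hy hsz.right_mem hst.right_mem hz ht)
    (potential_z.trans potential_t'.symm)).1 hsz
  exact hsep (ReachIn.trans t'_mem hst.symm)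

end Separation

section Geometry

variable (k : ℕ) (u α y : ℕ → ℕ) (n : ℕ)

/-- The vertices over the union of the boxes `B₃ₙ` and `B'ₙ`. -/
abbrev RegionVertex : Type := lift k (region y n)

instance : Finite (RegionVertex k y n) := by
  refine ((window k (-(3 * n)) (3 * n) (-(3 * n) - n) (3 * n + y (3 * n) + n)).finite_toSet.subset
    fun v hv => ?_).to_subtype
  rw [mem_lift, mem_region] at hv
  rw [Finset.mem_coe, mem_window]
  omega

noncomputable instance : Fintype (RegionVertex k y n) := Fintype.ofFinite _

/-- The setting of the gluing lemma for the slab: the columns are the fibres over `ℤ²`. -/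
def slabGluingData : GluingData (RegionVertex k y n) (ℤ × ℤ) where
  G := (slab k).induce (lift k (region y n))
  col v := v.1.1
  B := {v | v.1.1 ∈ box (3 * n)}
  B' := {v | v.1.1 ∈ B' y n}
  S := {v | v.1.1 ∈ S u (3 * n)}
  S' := {v | v.1.1 ∈ S' u y n}
  Z := {v | v.1.1 ∈ Z α y n}
  Yminus := {v | v.1.1 ∈ Yminus α y n}
  Yplus := {v | v.1.1 ∈ Yplus α y n}

variable {k u α y n}

instance : Std.Symm PlanarStep :=
  ⟨fun v w h => by rwa [PlanarStep, abs_sub_comm w.1, abs_sub_comm w.2]⟩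

lemma reachIn_S' {A : Set (ℤ × ℤ)} (hA : S' u y n ⊆ A) {s₁ s₂ : ℤ × ℤ} (h₁ : s₁ ∈ S' u y n)
    (h₂ : s₂ ∈ S' u y n) : ReachIn PlanarStep A s₁ s₂ := by
  obtain ⟨a₁, b₁⟩ := s₁
  obtain ⟨a₂, b₂⟩ := s₂
  rw [mem_S'] at h₁ h₂
  dsimp only at h₁ h₂
  have horizontal : ReachIn PlanarStep A (a₁, b₁) (a₂, b₁) := by
    refine reachIn_line (fun i => (i, b₁)) a₁ a₂ (fun i _ _ => hA ?_) fun i => ?_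
    · rw [mem_S']
      dsimp only
      omega
    · simp [PlanarStep]
  have vertical : ReachIn PlanarStep A (a₂, b₁) (a₂, b₂) := by
    refine reachIn_line (fun i => (a₂, i)) b₁ b₂ (fun i _ _ => hA ?_) fun i => ?_
    · rw [mem_S']
      dsimp only
      omega
    · simp [PlanarStep]
  exact horizontal.trans vertical

lemma S'_subset_B' (hu : u n ≤ n) : S' u y n ⊆ B' y n := by
  intro v hv
  rw [mem_S'] at hv
  rw [mem_B']
  omega

/-- The two paths from `S'` form, together with `S'`, a path in the plane from `Yminus` to `Yplus`,
which a path from `S` to `Z` has to cross. -/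
lemma slabGluingData_separates (hu : ∀ m, 3 * u m ≤ m) {γ : List (RegionVertex k y n)}
    (hγ : γ.IsChain (slabGluingData k u α y n).G.Adj) (hB : ∀ v ∈ γ, v.1.1 ∈ box (3 * n))
    (hhead : ∃ a ∈ γ.head?, a.1.1 ∈ S u (3 * n)) (hlast : ∃ b ∈ γ.getLast?, b.1.1 ∈ Z α y n)
    (hS' : ∀ v ∈ γ, v.1.1 ∉ S' u y n) {s₁ s₂ y₁ y₂ : RegionVertex k y n}
    (hs₁ : s₁.1.1 ∈ S' u y n) (hs₂ : s₂.1.1 ∈ S' u y n) (hy₁ : y₁.1.1 ∈ Yminus α y n)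
    (hy₂ : y₂.1.1 ∈ Yplus α y n)
    (h₁ : ReachIn (slabGluingData k u α y n).G.Adj
      ((slabGluingData k u α y n).B' ∩ (slabGluingData k u α y n).offCols γ) s₁ y₁)
    (h₂ : ReachIn (slabGluingData k u α y n).G.Adj
      ((slabGluingData k u α y n).B' ∩ (slabGluingData k u α y n).offCols γ) s₂ y₂) : False := by
  obtain ⟨a, ha, haS⟩ := hhead
  obtain ⟨t, rfl⟩ := List.head?_eq_some_iff.1 ha
  obtain ⟨b, hb, hbZ⟩ := hlast
  set H : Set (ℤ × ℤ) := {q | ∃ v ∈ a :: t, v.1.1 = q}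
  have project {v w} (h : ReachIn (slabGluingData k u α y n).G.Adj
      ((slabGluingData k u α y n).B' ∩ (slabGluingData k u α y n).offCols (a :: t)) v w) :
      ReachIn PlanarStep (B' y n \ H) v.1.1 w.1.1 :=
    h.map (fun v => v.1.1) (fun _ _ _ _ h => planarStep_of_adj h)
      fun v hv => ⟨hv.1, fun ⟨g, hg, hgv⟩ => hv.2 g hg hgv⟩
  have hS'_subset : S' u y n ⊆ B' y n \ H := by
    refine Set.subset_sdiff.2 ⟨S'_subset_B' (by linarith [hu n]), Set.disjoint_left.2 ?_⟩
    rintro _ hq ⟨v, hv, rfl⟩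
    exact hS' v hv hq
  have path_from_Yminus : ReachIn PlanarStep (B' y n \ H) y₁.1.1 y₂.1.1 :=
    (project h₁).symm.trans ((reachIn_S' hS'_subset hs₁ hs₂).trans (project h₂))
  have path_from_S : ReachIn PlanarStep H a.1.1 b.1.1 :=
    (reachIn_of_isChain hγ hb).map (fun v => v.1.1) (fun _ _ _ _ h => planarStep_of_adj h)
      fun v hv => ⟨v, hv, rfl⟩
  have H_left (q) (hq : q ∈ H) : q.1 ≤ 3 * n := by
    obtain ⟨v, hv, rfl⟩ := hq
    have := mem_box.1 (hB v hv)
    push_cast at this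
    exact this.1.2
  rw [mem_Yminus] at hy₁
  rw [mem_Yplus] at hy₂
  rw [mem_Z] at hbZ
  rw [S, mem_box] at haS
  have := hu (3 * n)
  exact planar_paths_meet (xl := n) (xr := 3 * n) (fun v hv => (mem_B'.1 hv.1).1) H_left
    path_from_Yminus path_from_S hy₁.1 hy₂.1 hbZ.1 (by omega) (by omega) (by omega)
    Set.disjoint_sdiff_left

lemma isSeparating_slabGluingData (hu : ∀ m, 3 * u m ≤ m) :
    (slabGluingData k u α y n).IsSeparating where
  mem_S v x hvx hv := by
    change x.1.1 ∈ S u (3 * n)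
    rwa [← show v.1.1 = x.1.1 from hvx]
  mem_S' v x hvx hv := by
    change x.1.1 ∈ S' u y n
    rwa [← show v.1.1 = x.1.1 from hvx]
  column_connected v x hvx := by
    obtain ⟨⟨z, i⟩, hv⟩ := v
    obtain ⟨⟨z', j⟩, hx⟩ := x
    obtain rfl : z = z' := hvx
    have column_subset : {v : Vertex k | v.1 = z} ⊆ lift k (region y n) := by
      rintro w rfl
      exact hv
    exact (reachIn_subtype_iff column_subset (x := ⟨(z, i), hv⟩) (y := ⟨(z, j), hx⟩)).2
      (reachIn_column z i j)
  separates _ hγ hB hhead hlast hS' _ hs₁ _ hs₂ _ hy₁ _ hy₂ h₁ h₂ :=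
    slabGluingData_separates hu hγ hB hhead hlast hS' hs₁ hs₂ hy₁ hy₂ h₁ h₂

/-- A bound on the number of coordinates that belong to a given column. -/
def starConst (k : ℕ) : ℕ := 2 * (9 * (k + 1)) ^ 2

lemma card_window_around (z : ℤ × ℤ) :
    (window k (z.1 - 1) (z.1 + 1) (z.2 - 1) (z.2 + 1)).card = 9 * (k + 1) := by
  have side (x : ℤ) : (x + 1 + 1 - (x - 1)).toNat = 3 := by omega
  rw [card_window, side, side]

lemma mem_window_of_adj {a b : Vertex k} (h : (slab k).Adj a b) :
    b ∈ window k (a.1.1 - 1) (a.1.1 + 1) (a.1.2 - 1) (a.1.2 + 1) := by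
  have := abs_sub_le_one_of_adj h
  rw [abs_le, abs_le] at this
  rw [mem_window]
  omega

lemma card_star_le (z : ℤ × ℤ) : ((slabGluingData k u α y n).star z).card ≤ starConst k := by
  classical
  set Q := window k (z.1 - 1) (z.1 + 1) (z.2 - 1) (z.2 + 1) with hQ
  have mem_Q {a b : Vertex k} (h : (slab k).Adj a b) (ha : a.1 = z) : a ∈ Q ∧ b ∈ Q := by
    subst ha
    exact ⟨by simp [hQ, mem_window], mem_window_of_adj h⟩
  set f : Coord (RegionVertex k y n) → Sym2 (Vertex k) ⊕ (Vertex k × Vertex k) :=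
    Sum.map (Sym2.map Subtype.val) (Prod.map Subtype.val Subtype.val)
  have f_injective : Function.Injective f :=
    (Sym2.map.injective Subtype.val_injective).sumMap
      (Subtype.val_injective.prodMap Subtype.val_injective)
  have mapsTo : Set.MapsTo f ((slabGluingData k u α y n).star z)
      (((Q ×ˢ Q).image fun q => s(q.1, q.2)).disjSum (Q ×ˢ Q)) := by
    rintro (e | ⟨a, b⟩) hi
    · obtain ⟨he, v, hv, hvz⟩ := GluingData.inl_mem_star.1 hi
      obtain ⟨w, rfl⟩ := hv
      exact Finset.inl_mem_disjSum.2
        (Finset.mem_image.2 ⟨(v.1, w.1), Finset.mem_product.2 (mem_Q he hvz), rfl⟩)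
    · obtain ⟨haz, hab⟩ := GluingData.inr_mem_star.1 hi
      exact Finset.inr_mem_disjSum.2 (Finset.mem_product.2 (mem_Q hab haz))
  calc ((slabGluingData k u α y n).star z).card
      ≤ (((Q ×ˢ Q).image fun q => s(q.1, q.2)).disjSum (Q ×ˢ Q)).card :=
        Finset.card_le_card_of_injOn f mapsTo f_injective.injOn
    _ ≤ (Q ×ˢ Q).card + (Q ×ˢ Q).card := by
        rw [Finset.card_disjSum]
        exact Nat.add_le_add_right Finset.card_image_le _
    _ = starConst k := by
        rw [Finset.card_product, hQ, card_window_around, starConst]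
        ring

end Geometry

section Transfer

/-- The edges of the slab over the union of the boxes `B₃ₙ` and `B'ₙ`. -/
abbrev RegionEdge (k : ℕ) (y : ℕ → ℕ) (n : ℕ) : Type :=
  ((slab k).induce (lift k (region y n))).edgeSet

variable (k : ℕ) (u α y : ℕ → ℕ) (n : ℕ)

/-- The edges over the union of the boxes, as edges of the slab. -/
def toSlabEdge : RegionEdge k y n ↪ (slab k).edgeSet :=
  (SimpleGraph.Embedding.induce _).mapEdgeSet

/-- The edges over the union of the boxes, as coordinates of the states of `slabGluingData`. -/
def toCoord : RegionEdge k y n ↪ Coord (RegionVertex k y n) :=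
  (Function.Embedding.subtype _).trans .inl

variable {k y n}

/-- Adjacency along the open edges of a configuration `ζ` over the union of the boxes. -/
def regionOpenAdj (ζ : RegionEdge k y n → Bool) (v w : RegionVertex k y n) : Prop :=
  ∃ h : s(v, w) ∈ ((slab k).induce (lift k (region y n))).edgeSet, ζ ⟨s(v, w), h⟩ = true

/-- The event that `X` and `Y` are connected in `B`, for configurations over the union of the
boxes only. -/
def RegionJoins (ζ : RegionEdge k y n → Bool) (B X Y : Set (ℤ × ℤ)) : Prop :=
  ∃ a, a.1.1 ∈ X ∧ ∃ b, b.1.1 ∈ Y ∧ ReachIn (regionOpenAdj ζ) {v | v.1.1 ∈ B} a b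

variable {u α}

lemma joins_iff_regionJoins (η : State (RegionVertex k y n)) (B X Y : Set (ℤ × ℤ)) :
    (slabGluingData k u α y n).Joins η {v | v.1.1 ∈ B} {v | v.1.1 ∈ X} {v | v.1.1 ∈ Y} ↔
      RegionJoins (η ∘ toCoord k y n) B X Y := by
  have openAdj_eq :
      (slabGluingData k u α y n).OpenAdj η = regionOpenAdj (η ∘ toCoord k y n) := by
    ext v w
    exact ⟨fun ⟨h, ho⟩ => ⟨h, ho⟩, fun ⟨h, ho⟩ => ⟨h, ho⟩⟩
  rw [GluingData.Joins, openAdj_eq]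
  rfl

lemma mem_connected_iff_regionJoins (ω : Config k) {B : Set (ℤ × ℤ)} (hB : B ⊆ region y n)
    (X Y : Set (ℤ × ℤ)) : ω ∈ connected k B X Y ↔ RegionJoins (ω ∘ toSlabEdge k y n) B X Y := by
  have openAdj_eq : regionOpenAdj (ω ∘ toSlabEdge k y n) =
      fun v w => (openGraph ω).Adj v.1 w.1 := by
    ext v w
    exact ⟨fun ⟨h, ho⟩ => ⟨h, ho⟩, fun ⟨h, ho⟩ => ⟨h, ho⟩⟩
  have reachIn_iff (a b : RegionVertex k y n) :
      ReachIn (fun v w : RegionVertex k y n => (openGraph ω).Adj v.1 w.1) {v | v.1.1 ∈ B} a b ↔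
        ReachIn (openGraph ω).Adj (lift k B) a.1 b.1 :=
    reachIn_subtype_iff (A := lift k B) fun _ hv => hB hv
  simp only [mem_connected_iff, RegionJoins, openAdj_eq, reachIn_iff]
  constructor
  · rintro ⟨a, ha, b, hb, h⟩
    exact ⟨⟨a, hB h.left_mem⟩, ha, ⟨b, hB h.right_mem⟩, hb, h⟩
  · rintro ⟨a, ha, b, hb, h⟩
    exact ⟨a, ha, b, hb, h⟩

variable (k u α y n)

/-- The event in the hypothesis of the gluing lemma. -/
def armsEvent : Set (Config k) :=
  connected k (box (3 * n)) (S u (3 * n)) (Z α y n) ∩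
    connected k (B' y n) (S' u y n) (Yminus α y n) ∩
    connected k (B' y n) (S' u y n) (Yplus α y n)

/-- The event in the conclusion of the gluing lemma. -/
def gluedEvent : Set (Config k) :=
  connected k (box (3 * n) ∪ B' y n) (S u (3 * n)) (S' u y n)

/-- `armsEvent` for configurations over the union of the boxes. -/
def regionArmsEvent : Set (RegionEdge k y n → Bool) :=
  {ζ | RegionJoins ζ (box (3 * n)) (S u (3 * n)) (Z α y n) ∧
    RegionJoins ζ (B' y n) (S' u y n) (Yminus α y n) ∧
    RegionJoins ζ (B' y n) (S' u y n) (Yplus α y n)}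

/-- `gluedEvent` for configurations over the union of the boxes. -/
def regionGluedEvent : Set (RegionEdge k y n → Bool) :=
  {ζ | RegionJoins ζ (region y n) (S u (3 * n)) (S' u y n)}

lemma armsEvent_eq_preimage :
    armsEvent k u α y n = {ω | ω ∘ toSlabEdge k y n ∈ regionArmsEvent k u α y n} := by
  ext ω
  rw [armsEvent, Set.mem_inter_iff, Set.mem_inter_iff, and_assoc,
    mem_connected_iff_regionJoins ω Set.subset_union_left,
    mem_connected_iff_regionJoins ω Set.subset_union_right,
    mem_connected_iff_regionJoins ω Set.subset_union_right]
  rfl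

lemma gluedEvent_eq_preimage :
    gluedEvent k u y n = {ω | ω ∘ toSlabEdge k y n ∈ regionGluedEvent k u y n} := by
  ext ω
  exact mem_connected_iff_regionJoins ω subset_rfl _ _

variable {k u α y n}

lemma hasArms_iff (η : State (RegionVertex k y n)) :
    (slabGluingData k u α y n).HasArms η ↔ η ∘ toCoord k y n ∈ regionArmsEvent k u α y n :=
  and_congr (joins_iff_regionJoins η _ _ _)
    (and_congr (joins_iff_regionJoins η _ _ _) (joins_iff_regionJoins η _ _ _))

lemma joins_univ_iff (η : State (RegionVertex k y n)) :
    (slabGluingData k u α y n).Joins η Set.univ (slabGluingData k u α y n).S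
      (slabGluingData k u α y n).S' ↔ η ∘ toCoord k y n ∈ regionGluedEvent k u y n := by
  have region_eq_univ : {v : RegionVertex k y n | v.1.1 ∈ region y n} = Set.univ :=
    Set.eq_univ_of_forall fun v => v.2
  rw [← region_eq_univ]
  exact joins_iff_regionJoins η _ _ _

lemma measurableSet_armsEvent : MeasurableSet (armsEvent k u α y n) := by
  rw [armsEvent_eq_preimage]
  exact measurableSet_preimage (by fun_prop) (Set.toFinite _).measurableSet

lemma measurableSet_gluedEvent : MeasurableSet (gluedEvent k u y n) := by
  rw [gluedEvent_eq_preimage]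
  exact measurableSet_preimage (by fun_prop) (Set.toFinite _).measurableSet

variable (μ : Measure Bool) [IsProbabilityMeasure μ]

lemma real_preimage_toSlabEdge_eq (A : Set (RegionEdge k y n → Bool)) :
    (iidMeasure (slab k).edgeSet μ).real {ω | ω ∘ toSlabEdge k y n ∈ A} =
      (iidMeasure (Coord (RegionVertex k y n)) μ).real {η | η ∘ toCoord k y n ∈ A} := by
  rw [iidMeasure_real_comp_mem μ (toSlabEdge k y n).injective,
    iidMeasure_real_comp_mem μ (toCoord k y n).injective]

lemma real_compl_armsEvent_eq : (iidMeasure (slab k).edgeSet μ).real (armsEvent k u α y n)ᶜ =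
    (iidMeasure (Coord (RegionVertex k y n)) μ).real
      {η | ¬ (slabGluingData k u α y n).HasArms η} := by
  simp only [hasArms_iff, armsEvent_eq_preimage]
  exact real_preimage_toSlabEdge_eq μ (regionArmsEvent k u α y n)ᶜ

lemma real_compl_gluedEvent_eq : (iidMeasure (slab k).edgeSet μ).real (gluedEvent k u y n)ᶜ =
    (iidMeasure (Coord (RegionVertex k y n)) μ).real {η | ¬ (slabGluingData k u α y n).Joins η
      Set.univ (slabGluingData k u α y n).S (slabGluingData k u α y n).S'} := by
  simp only [joins_univ_iff, gluedEvent_eq_preimage]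
  exact real_preimage_toSlabEdge_eq μ (regionGluedEvent k u y n)ᶜ

variable {μ}

theorem real_compl_gluedEvent_le (hu : ∀ m, 3 * u m ≤ m) (α : ℕ → ℕ) {m : ℝ} (hm : 0 < m)
    (hμ : ∀ b, m ≤ μ.real {b}) {t : ℕ} (ht : 0 < t) :
    (iidMeasure (slab k).edgeSet μ).real (gluedEvent k u y n)ᶜ ≤
      (1 + (2 * m⁻¹) ^ (t * starConst k)) *
          (iidMeasure (slab k).edgeSet μ).real (armsEvent k u α y n)ᶜ +
        (2 * m⁻¹) ^ starConst k / t := by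
  classical
  let _ : LinearOrder (RegionVertex k y n) := linearOrderOfSTO WellOrderingRel
  rw [real_compl_armsEvent_eq, real_compl_gluedEvent_eq (α := α)]
  exact (slabGluingData k u α y n).real_not_joins_le hm hμ card_star_le
    (isSeparating_slabGluingData hu) t ht

end Transfer

section Gluing

variable {k : ℕ} {u α y : ℕ → ℕ} {n : ℕ} (μ : Measure Bool) [IsProbabilityMeasure μ]

lemma ReachIn.to_region {r : Vertex k → Vertex k → Prop} {B : Set (ℤ × ℤ)}
    (hB : B ⊆ region y n) {a b : Vertex k} (h : ReachIn r (lift k B) a b) :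
    ReachIn r (lift k (region y n)) a b :=
  h.mono (fun _ _ _ _ h => h) fun _ hv => hB hv

theorem real_armsEvent_le (hu : ∀ m, 3 * u m ≤ m) (hy : ∀ m, y m ≤ m) (hn : 1 ≤ n) :
    (iidMeasure (slab k).edgeSet μ).real (armsEvent k u α y n) ≤ chainConst k * μ.real {true} := by
  have hun := hu n
  refine le_trans (measureReal_mono ?_ (measure_ne_top _ _))
    (iidMeasure_real_linked_le μ true (n := n) (x₀ := 2 * n + u n) (by omega))
  rintro ω ⟨_, joins_Yplus⟩
  obtain ⟨s', hs', t', ht', hst⟩ := mem_connected_iff.1 joins_Yplus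
  rw [mem_lift, mem_S'] at hs'
  rw [mem_lift, mem_Yplus] at ht'
  exact linked_of_reachIn (hy _) (hst.to_region Set.subset_union_right) hs'.1.2 (by omega) ht'.1

theorem real_armsEvent_diff_gluedEvent_le (hu : ∀ m, 3 * u m ≤ m) (hy : ∀ m, y m ≤ m) :
    (iidMeasure (slab k).edgeSet μ).real (armsEvent k u α y n \ gluedEvent k u y n) ≤
      chainConst k * μ.real {false} := by
  have hun := hu n
  have hu3n := hu (3 * n)
  refine le_trans (measureReal_mono ?_ (measure_ne_top _ _))
    (iidMeasure_real_linked_le μ false (n := n) (x₀ := 2 * n + u n) (by omega))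
  rintro ω ⟨⟨⟨joins_Z, _⟩, joins_Yplus⟩, not_glued⟩
  obtain ⟨s, hs, z, hz, hsz⟩ := mem_connected_iff.1 joins_Z
  obtain ⟨s', hs', t', ht', hst⟩ := mem_connected_iff.1 joins_Yplus
  have separated : ¬ ReachIn (openGraph ω).Adj (lift k (region y n)) s s' := fun hss =>
    not_glued (mem_connected_iff.2 ⟨s, hs, s', hs', hss⟩)
  rw [mem_lift, mem_S'] at hs'
  rw [mem_lift, mem_Yplus] at ht'
  rw [mem_lift, S, mem_box] at hs
  rw [mem_lift, mem_Z] at hz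
  exact linked_of_separated (hy _) (by omega) (hsz.to_region Set.subset_union_left)
    (hst.to_region Set.subset_union_right) separated (by omega) hs'.1.2 hz.1 ht'.1

/-- Densities near `0` and `1` need separate arguments, since the cost of a local modification is
bounded only when both states of an edge have probability bounded below. -/
theorem exists_real_compl_gluedEvent_le (k : ℕ) {ε : ℝ} (hε : 0 < ε) :
    ∃ c : ℝ, 1 ≤ c ∧ ∀ (μ : Measure Bool) [IsProbabilityMeasure μ] (u α y : ℕ → ℕ),
      (∀ m, 3 * u m ≤ m) → (∀ m, y m ≤ m) → ∀ n : ℕ, 1 ≤ n →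
      1 / 2 < (iidMeasure (slab k).edgeSet μ).real (armsEvent k u α y n) →
      (iidMeasure (slab k).edgeSet μ).real (gluedEvent k u y n)ᶜ ≤
        c * (iidMeasure (slab k).edgeSet μ).real (armsEvent k u α y n)ᶜ + ε := by
  have hK : (0 : ℝ) < chainConst k := by exact_mod_cast chainConst_pos k
  set m : ℝ := min (1 / 2) ε / chainConst k
  have hm : 0 < m := by positivity
  have chainConst_mul_le {q : ℝ} (hq : q < m) : chainConst k * q ≤ min (1 / 2) ε := by
    rw [lt_div_iff₀' hK] at hq
    exact hq.le
  obtain ⟨t, ht⟩ := exists_nat_gt ((2 * m⁻¹) ^ starConst k / ε)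
  have t_pos : (0 : ℝ) < t := lt_of_le_of_lt (by positivity) ht
  have error_le : (2 * m⁻¹) ^ starConst k / t ≤ ε := by
    rw [div_lt_iff₀ hε] at ht
    rw [div_le_iff₀ t_pos]
    linarith
  have one_le : 1 ≤ 1 + (2 * m⁻¹) ^ (t * starConst k) := le_add_of_nonneg_right (by positivity)
  refine ⟨_, one_le, fun μ _ u α y hu hy n hn harms => ?_⟩
  rcases lt_or_ge (μ.real {true}) m with htrue | htrue
  · have few_open := (real_armsEvent_le (α := α) μ hu hy hn).trans (chainConst_mul_le htrue)
    linarith [min_le_left (1 / 2) ε]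
  rcases lt_or_ge (μ.real {false}) m with hfalse | hfalse
  · have few_closed := (real_armsEvent_diff_gluedEvent_le (α := α) (n := n) μ hu hy).trans
      (chainConst_mul_le hfalse)
    have cover : (gluedEvent k u y n)ᶜ ⊆
        (armsEvent k u α y n)ᶜ ∪ (armsEvent k u α y n \ gluedEvent k u y n) := by
      intro ω hω
      by_cases ω ∈ armsEvent k u α y n <;> simp_all
    have union_bound := (measureReal_mono (μ := iidMeasure (slab k).edgeSet μ) cover
      (measure_ne_top _ _)).trans (measureReal_union_le _ _)
    have := le_mul_of_one_le_left (measureReal_nonneg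
      (μ := iidMeasure (slab k).edgeSet μ) (s := (armsEvent k u α y n)ᶜ)) one_le
    linarith [min_le_right (1 / 2) ε]
  · have bound := real_compl_gluedEvent_le (k := k) (y := y) (n := n) hu α hm
      (Bool.forall_bool.2 ⟨hfalse, htrue⟩) (by exact_mod_cast t_pos : 0 < t)
    linarith

end Gluing

end SlabPercolation

theorem mainTheorem4 (k : ℕ) (ε : ℝ) (hε : 0 < ε) :
    ∃ δ : ℝ, 0 < δ ∧
      ∀ (p : unitInterval) (u α y : ℕ → ℕ),
        (∀ m, 3 * u m ≤ m) → (∀ m, α m ≤ m) → (∀ m, y m ≤ m) →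
        ∀ n : ℕ, 1 ≤ n →
          1 - δ ≤ (SlabPercolation.bernoulliPerc k p).real
            (SlabPercolation.connected k (SlabPercolation.box (3 * n))
                (SlabPercolation.S u (3 * n)) (SlabPercolation.Z α y n) ∩
              SlabPercolation.connected k (SlabPercolation.B' y n)
                (SlabPercolation.S' u y n) (SlabPercolation.Yminus α y n) ∩
              SlabPercolation.connected k (SlabPercolation.B' y n)
                (SlabPercolation.S' u y n) (SlabPercolation.Yplus α y n)) →
          1 - ε ≤ (SlabPercolation.bernoulliPerc k p).real
            (SlabPercolation.connected k
              (SlabPercolation.box (3 * n) ∪ SlabPercolation.B' y n)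
              (SlabPercolation.S u (3 * n)) (SlabPercolation.S' u y n)) := by
  obtain ⟨c, hc, bound⟩ := SlabPercolation.exists_real_compl_gluedEvent_le k (half_pos hε)
  have c_pos : 0 < c := one_pos.trans_le hc
  refine ⟨min (1 / 4) (ε / (2 * c)), by positivity, fun p u α y hu _ hy n hn harms => ?_⟩
  set δ := min (1 / 4) (ε / (2 * c))
  have δ_le : δ ≤ 1 / 4 := min_le_left _ _
  have c_mul_δ_le : c * δ ≤ ε / 2 := calc
    c * δ ≤ c * (ε / (2 * c)) := mul_le_mul_of_nonneg_left (min_le_right _ _) c_pos.le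
    _ = ε / 2 := by field_simp
  set μ := ProbabilityTheory.bernoulliMeasure true false p
  change 1 - δ ≤
    (SlabPercolation.iidMeasure _ μ).real (SlabPercolation.armsEvent k u α y n) at harms
  change 1 - ε ≤ (SlabPercolation.iidMeasure _ μ).real (SlabPercolation.gluedEvent k u y n)
  have not_glued_le := bound μ u α y hu hy n hn (by linarith)
  rw [probReal_compl_eq_one_sub SlabPercolation.measurableSet_armsEvent,
    probReal_compl_eq_one_sub SlabPercolation.measurableSet_gluedEvent] at not_glued_le
  have := mul_le_mul_of_nonneg_left harms c_pos.le
  linarith
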